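/- Let $(a)_n=a(a+1)\cdots(a+n-1)$, and let $C_n^{\lambda}$ be the Gegenbauer polynomials, $\sum_{n\ge 0}C_n^{\lambda}(x)t^n=(1-2xt+t^2)^{-\lambda}$. Put $R=(1-2xt+t^2)^{1/2}$, with $R=1$ at $t=0$, and $$f_\pm=\Bigl\{\sinh\xi\Bigl[\pm\cosh(\xi/3)+\sqrt{\tfrac{\sinh\xi}{3\sinh(\xi/3)}}\,\Bigr]\Bigr\}^{1/4},\qquad g_\pm=\Bigl\{\cosh\xi\Bigl[\pm\sinh(\xi/3)+\sqrt{\tfrac{\cosh\xi}{3\cosh(\xi/3)}}\,\Bigr]\Bigr\}^{1/4}.$$ All powers, roots and logarithms of complex numbers below have their principal values, except for the roots $\sqrt{x^2-1}$ and $\sqrt{1-x^2}$, whose choice is described in (a) and (b). Let $x\in\mathbb{C}$, $x\ne\pm1$. Then for all $t\neq0$ of sufficiently small modulus (depending on $x$) the following hold, the series being convergent. (a) For any choice of $\sqrt{x^2-1}$ with $\operatorname{Re}(t\sqrt{x^2-1})\ge 0$ (for instance, $t>0$ and the positive root when $x$ is real with $|x|>1$), one has $1-R-xt\neq 0$ and,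 with $\xi=\log\bigl[t\sqrt{x^2-1}/(1-R-xt)\bigr]$, $$\sum_{n=0}^\infty\frac{(-1/12)_n}{(1/3)_n}C_n^{1/6}(x)t^n=2^{-7/12}3^{-3/8}R^{1/12}(\sinh\xi)^{-1/3}\Bigl[\sqrt{\sqrt3+1}\,f_++\sqrt{\sqrt3-1}\,f_-\Bigr].$$ (b) For any choice of $\sqrt{1-x^2}$ with $\operatorname{Re}(t\sqrt{1-x^2})\ge 0$ (for instance, $t>0$ and the positive root when $-1<x<1$), one has $-1+R+xt\neq 0$ and, with $\xi=\log\bigl[t\sqrt{1-x^2}/(-1+R+xt)\bigr]$, $$\sum_{n=0}^\infty\frac{(-1/12)_n}{(1/3)_n}C_n^{1/6}(x)t^n=2^{-7/12}3^{-3/8}R^{1/12}(\cosh\xi)^{-1/3}\Bigl[\sqrt{\sqrt3+1}\,g_++\sqrt{\sqrt3-1}\,g_-\Bigr].$$ Moreover, the generating function is algebraic: the formal power series $\sum_{n}\frac{(-1/12)_n}{(1/3)_n}C_n^{1/6}(x)t^n\in\mathbb{C}[x][[t]]$ is algebraic over $\mathbb{C}[x][t]$. -/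

import Mathlib

open Polynomial

noncomputable section

/-- The Pochhammer symbol `(a)_n = a (a + 1) ⋯ (a + n - 1)`. -/
def poch (a : ℂ) (n : ℕ) : ℂ := (ascPochhammer ℂ n).eval a

/-- The Gegenbauer polynomial `C_n^l`, as a polynomial in its argument. The theorem
`gegenbauer_hasSum` below is the defining relation `∑ C_n^l(x) t^n = (1 - 2xt + t²)^(-l)`. -/
def gegenbauer (l : ℂ) (n : ℕ) : ℂ[X] :=
  ∑ k ∈ Finset.range (n / 2 + 1),
    C ((-1) ^ k * poch l (n - k) / ((k.factorial : ℂ) * ((n - 2 * k).factorial : ℂ))) *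
      (C 2 * X) ^ (n - 2 * k)

theorem binomial_norm_hasSum (l w : ℂ) (hw : ‖w‖ < 1) :
    Summable (fun j : ℕ => ‖poch l j / (j.factorial : ℂ)‖ * ‖w‖ ^ j) ∧
    HasSum (fun j : ℕ => poch l j / (j.factorial : ℂ) * w ^ j) ((1 - w) ^ (-l)) := by
  have h := Complex.one_div_one_sub_cpow_hasFPowerSeriesOnBall_zero l
  have hc : ∀ j : ℕ, Ring.choose (l + j - 1) j = poch l j / (j.factorial : ℂ) := by
    intro j
    rw [← Ring.multichoose_eq, eq_div_iff (by exact_mod_cast j.factorial_ne_zero), mul_comm, ← nsmul_eq_mul,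
      Ring.factorial_nsmul_multichoose_eq_ascPochhammer, poch, Polynomial.ascPochhammer_smeval_eq_eval]
  simp only [hc] at h
  have hw' : w ∈ Metric.eball (0 : ℂ) 1 := by
    simpa [← ENNReal.ofReal_one, Metric.eball_ofReal] using hw
  constructor
  · have := FormalMultilinearSeries.summable_norm_mul_pow (r := ‖w‖₊) _
      (lt_of_lt_of_le (by exact_mod_cast hw) h.r_le)
    simpa [FormalMultilinearSeries.ofScalars_norm] using this
  · have := h.hasSum hw'
    simpa [FormalMultilinearSeries.ofScalars_apply_eq, Complex.cpow_neg, mul_comm] using this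

theorem gegenbauer_hasSum (l x t : ℂ) (h : 2 * ‖x‖ * ‖t‖ + ‖t‖ ^ 2 < 1) :
    HasSum (fun n : ℕ => (gegenbauer l n).eval x * t ^ n) ((1 - 2 * x * t + t ^ 2) ^ (-l)) := by
  set a : ℕ × ℕ → ℂ := fun p => poch l (p.1 + p.2) /
    ((p.1.factorial : ℂ) * (p.2.factorial : ℂ)) * ((2 * x * t) ^ p.1 * (-t ^ 2) ^ p.2) with ha
  set u : ℝ := 2 * ‖x‖ * ‖t‖ + ‖t‖ ^ 2 with hu
  have hu0 : 0 ≤ u := by positivity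
  have key : ∀ (j : ℕ) (p : ℕ × ℕ), p ∈ Finset.HasAntidiagonal.antidiagonal j →
      poch l (p.1 + p.2) / ((p.1.factorial : ℂ) * (p.2.factorial : ℂ)) =
        poch l j / (j.factorial : ℂ) * (j.choose p.1 : ℂ) := by
    intro j p hp
    rw [Finset.HasAntidiagonal.mem_antidiagonal] at hp
    subst hp
    have := Nat.add_choose_mul_factorial_mul_factorial p.1 p.2
    rw [← this, Nat.choose_symm_add.symm]
    have h3 : ((p.1 + p.2).choose p.1 : ℂ) ≠ 0 := by
      exact_mod_cast (Nat.choose_pos (Nat.le_add_right _ _)).ne'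
    push_cast
    field_simp
  have hnorm : Summable fun p => ‖a p‖ := by
    rw [← Finset.HasAntidiagonal.sigmaAntidiagonalEquivProd.summable_iff]
    refine (summable_sigma_of_nonneg (fun _ => norm_nonneg _)).2
      ⟨fun _ => Summable.of_finite, ?_⟩
    have h1 := (binomial_norm_hasSum l (u : ℂ) (by simpa [abs_of_nonneg hu0] using h)).1
    refine h1.congr fun j => ?_
    rw [tsum_fintype, Finset.univ_eq_attach]
    simp only [Finset.HasAntidiagonal.sigmaAntidiagonalEquivProd_apply]
    rw [Finset.sum_attach (Finset.HasAntidiagonal.antidiagonal j) (fun p => ‖a p‖), Complex.norm_real,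
      Real.norm_of_nonneg hu0, hu, (Commute.all _ _).add_pow', Finset.mul_sum]
    refine Finset.sum_congr rfl fun p hp => ?_
    simp only [ha]
    rw [key j p hp]
    simp [mul_assoc]
  have hsum : HasSum a ((1 - 2 * x * t + t ^ 2) ^ (-l)) := by
    have hs := hnorm.of_norm.hasSum
    have h2 := (Finset.HasAntidiagonal.sigmaAntidiagonalEquivProd.hasSum_iff.2 hs).sigma
      (fun j => hasSum_fintype _)
    have hw : ‖2 * x * t - t ^ 2‖ < 1 := by
      refine lt_of_le_of_lt (norm_sub_le _ _) ?_
      simpa using h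
    have h3 := (binomial_norm_hasSum l _ hw).2
    have h4 : (1 : ℂ) - 2 * x * t + t ^ 2 = 1 - (2 * x * t - t ^ 2) := by ring
    rw [h4]
    convert! hs using 1
    refine h3.unique ?_
    convert! h2 using 2 with j
    rw [Finset.univ_eq_attach]
    simp only [Function.comp, Finset.HasAntidiagonal.sigmaAntidiagonalEquivProd_apply]
    rw [Finset.sum_attach (Finset.HasAntidiagonal.antidiagonal j) a, sub_eq_add_neg, (Commute.all _ _).add_pow',
      Finset.mul_sum]
    refine Finset.sum_congr rfl fun p hp => ?_
    simp only [ha]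
    rw [key j p hp]
    simp [mul_assoc]
  let f : (Σ n : ℕ, Fin (n / 2 + 1)) → ℕ × ℕ := fun s => (s.1 - 2 * s.2.1, s.2.1)
  have hf : Function.Bijective f := by
    constructor
    · rintro ⟨n, k, hk⟩ ⟨n', k', hk'⟩ he
      simp only [f, Prod.mk.injEq] at he
      obtain ⟨h1, rfl⟩ := he
      obtain rfl : n = n' := by omega
      rfl
    · rintro ⟨m, i⟩
      exact ⟨⟨m + 2 * i, ⟨i, by omega⟩⟩, by simp [f]⟩
  have h5 := ((Equiv.ofBijective f hf).hasSum_iff.2 hsum).sigma (fun j => hasSum_fintype _)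
  convert! h5 using 2 with n
  rw [gegenbauer, Polynomial.eval_finsetSum, Finset.sum_mul, Finset.sum_range]
  refine Finset.sum_congr rfl fun k _ => ?_
  have hk : 2 * k.1 ≤ n := by omega
  simp only [Function.comp, Equiv.ofBijective_apply, f, ha]
  rw [show n - 2 * k.1 + k.1 = n - k.1 by omega, mul_pow (2 * x) t, neg_pow (t ^ 2), ← pow_mul]
  have ht : t ^ n = t ^ (n - 2 * k.1) * t ^ (2 * k.1) := by rw [← pow_add, Nat.sub_add_cancel hk]
  rw [ht]
  simp only [eval_mul, eval_C, eval_pow, eval_X]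
  field_simp

/-- The coefficient `(-1/12)_n / (1/3)_n`. -/
def coeff16 (n : ℕ) : ℂ := poch (-1 / 12) n / poch (1 / 3) n

/-- `R = (1 - 2xt + t²)^(1/2)`, the branch with `R = 1` at `t = 0` (principal value, `t` small). -/
def bigR (x t : ℂ) : ℂ := (1 - 2 * x * t + t ^ 2) ^ (1 / 2 : ℂ)

/-- `f_+ (coth ξ)` for `e = 1` and `f_- (coth ξ)` for `e = -1`, as functions of `ξ`. -/
def fTetra (e ξ : ℂ) : ℂ :=
  (Complex.sinh ξ * (e * Complex.cosh (ξ / 3) +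
    (Complex.sinh ξ / (3 * Complex.sinh (ξ / 3))) ^ (1 / 2 : ℂ))) ^ (1 / 4 : ℂ)

/-- `g_+ (tanh ξ)` for `e = 1` and `g_- (tanh ξ)` for `e = -1`, as functions of `ξ`. -/
def gTetra (e ξ : ℂ) : ℂ :=
  (Complex.cosh ξ * (e * Complex.sinh (ξ / 3) +
    (Complex.cosh ξ / (3 * Complex.cosh (ξ / 3))) ^ (1 / 2 : ℂ))) ^ (1 / 4 : ℂ)

/-- The constant `2^(-7/12) 3^(-3/8)`. -/
def const16 : ℝ := (2 : ℝ) ^ (-7 / 12 : ℝ) * (3 : ℝ) ^ (-3 / 8 : ℝ)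

/-- The first right-hand side, at `ξ`. -/
def rhsF (x t ξ : ℂ) : ℂ :=
  (const16 : ℂ) * bigR x t ^ (1 / 12 : ℂ) * Complex.sinh ξ ^ (-1 / 3 : ℂ) *
    ((√(√3 + 1) : ℝ) * fTetra 1 ξ + (√(√3 - 1) : ℝ) * fTetra (-1) ξ)

/-- The second right-hand side, at `ξ`. -/
def rhsG (x t ξ : ℂ) : ℂ :=
  (const16 : ℂ) * bigR x t ^ (1 / 12 : ℂ) * Complex.cosh ξ ^ (-1 / 3 : ℂ) *
    ((√(√3 + 1) : ℝ) * gTetra 1 ξ + (√(√3 - 1) : ℝ) * gTetra (-1) ξ)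

/-- The generating function as a formal power series in `t` with coefficients in `ℂ[x]`. -/
def genFun16 : PowerSeries ℂ[X] := PowerSeries.mk fun n => C (coeff16 n) * gegenbauer (1 / 6) n

end

/-!
Fix `x` and put `R = (1 - 2xt + t²)^(1/2)`, `p = 1 - xt + R` and `q = (1 - xt - R) / p`, so that
`q → 0` as `t → 0`. The generating function equals `p^(1/12) Φ(y)` for any cube root `y` of `q`,
where `Φ` (`tetraSum`) is a combination of the two functions
`(((1 + y + y²) / 3)^(1/2) ± (1 + y) / 2)^(1/4)`.

This is proved through differential equations. Both functions solve the linear equation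
`(1 - y³) F'' = (3/2) y² F' - (3/16) y F`, whose coefficient recurrence has step three. The weights
in `Φ` make `Φ'(0) = 0`, so `Φ(y) = G(y³)` with `G` analytic at `0`, a multiple of the
hypergeometric function `₂F₁(-1/12, 1/4; 2/3; ·)` (`exists_tetraHyp`). On the other side, the factor
`n + 1/3` of the Gegenbauer recurrence cancels against `(1/3)_n`, so the coefficients of the
generating function satisfy a three-term recurrence (`coeff_genFunAt_recurrence`). It is the
recurrence attached to the equation satisfied by `p^(1/12) G(q)`, as follows from the simple formulas
`t q' / q = 2 / R` and `t p' / p = 1 - 1 / R`. The analytic solution being determined by its value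
at `0`, the two agree (`genFunAt_hasTaylor`). Recurrences and differential equations are exchanged
by means of the relation `HasTaylor` between formal power series and germs of functions.

In both forms of the right-hand side `exp ξ = p / (ts)`, which has argument at most slightly larger
than `π / 2` in absolute value. One takes `y = exp (-2ξ/3)` in the first form and `y = -exp (-2ξ/3)`
in the second. All quantities raised to a power are a real power of `exp ξ` times a factor close to
a positive real number, and the exponents of `exp ξ` are small enough for each principal power to
split (`rhs_eq_of_exp`); the powers of `exp ξ` then cancel.

For algebraicity, the closed form is viewed as a function of `(x, t)`. Absorbing `p^(1/12)` into
the fourth roots clears all denominators, so this function is integral over the polynomials in `x`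
and `t` (`isIntegralElem_closedForm`). The same monic polynomial annihilates the Taylor series in `t`
for every `x`, hence the formal power series with coefficients in `ℂ[x]`.
-/

open Filter Topology

/-! ### Taylor series of analytic germs at the origin -/

/-- `HasTaylor F f`: the formal power series `F` converges to the function `f` on a neighbourhood
of `0`. -/
def HasTaylor (F : PowerSeries ℂ) (f : ℂ → ℂ) : Prop :=
  ∀ᶠ t in 𝓝 (0 : ℂ), HasSum (fun n : ℕ => PowerSeries.coeff n F * t ^ n) (f t)

namespace HasTaylor

variable {F G : PowerSeries ℂ} {f g : ℂ → ℂ}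

theorem iff_hasFPowerSeriesAt : HasTaylor F f ↔
    HasFPowerSeriesAt f (FormalMultilinearSeries.ofScalars ℂ fun n => PowerSeries.coeff n F) 0 := by
  rw [hasFPowerSeriesAt_iff]
  simp [HasTaylor, FormalMultilinearSeries.coeff_ofScalars, mul_comm]

theorem analyticAt (h : HasTaylor F f) : AnalyticAt ℂ f 0 :=
  (iff_hasFPowerSeriesAt.1 h).analyticAt

/-- Every analytic germ has a Taylor series in this sense. -/
theorem of_analyticAt (h : AnalyticAt ℂ f 0) :
    HasTaylor (PowerSeries.mk fun n => iteratedDeriv n f 0 / (n.factorial : ℂ)) f := by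
  rw [iff_hasFPowerSeriesAt]
  simpa using h.hasFPowerSeriesAt

theorem congr (h : HasTaylor F f) (hfg : f =ᶠ[𝓝 0] g) : HasTaylor F g := by
  filter_upwards [h, hfg] with t ht he
  rwa [← he]

theorem unique_left (h : HasTaylor F f) (h' : HasTaylor G f) : F = G := by
  ext n
  have := (iff_hasFPowerSeriesAt.1 h).eq_formalMultilinearSeries (iff_hasFPowerSeriesAt.1 h')
  have := congrArg (fun p => FormalMultilinearSeries.coeff p n) this
  simpa [FormalMultilinearSeries.coeff_ofScalars] using this

theorem unique_right (h : HasTaylor F f) (h' : HasTaylor F g) : f =ᶠ[𝓝 0] g := by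
  filter_upwards [h, h'] with t ht ht' using ht.unique ht'

theorem coeff_eq (h : HasTaylor F f) (n : ℕ) :
    PowerSeries.coeff n F = iteratedDeriv n f 0 / (n.factorial : ℂ) := by
  rw [h.unique_left (of_analyticAt h.analyticAt), PowerSeries.coeff_mk]

theorem add (h : HasTaylor F f) (h' : HasTaylor G g) : HasTaylor (F + G) (fun t => f t + g t) := by
  filter_upwards [h, h'] with t ht ht'
  simpa [add_mul] using ht.add ht'

theorem mul (h : HasTaylor F f) (h' : HasTaylor G g) : HasTaylor (F * G) (fun t => f t * g t) := by
  filter_upwards [h, h'] with t ht ht'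
  -- Convergence in `ℂ` is absolute, so the Cauchy product applies.
  have h1 := ht.summable.norm
  have h2 := ht'.summable.norm
  have hs := (summable_norm_sum_mul_antidiagonal_of_summable_norm h1 h2).of_norm
  have he := tsum_mul_tsum_eq_tsum_sum_antidiagonal_of_summable_norm h1 h2
  rw [ht.tsum_eq, ht'.tsum_eq] at he
  rw [he]
  convert! hs.hasSum using 2 with n
  rw [PowerSeries.coeff_mul, Finset.sum_mul]
  refine Finset.sum_congr rfl fun p hp => ?_
  rw [← Finset.HasAntidiagonal.mem_antidiagonal.1 hp, pow_add]
  ring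

theorem const (a : ℂ) : HasTaylor (PowerSeries.C a) (fun _ => a) := by
  refine Eventually.of_forall fun t => ?_
  convert! hasSum_ite_eq (0 : ℕ) a using 2 with n
  by_cases hn : n = 0 <;> simp [PowerSeries.coeff_C, hn]

theorem id : HasTaylor PowerSeries.X (fun t => t) := by
  refine Eventually.of_forall fun t => ?_
  convert! hasSum_ite_eq (1 : ℕ) t using 2 with n
  by_cases hn : n = 1 <;> simp [PowerSeries.coeff_X, hn]

theorem const_mul (a : ℂ) (h : HasTaylor F f) :
    HasTaylor (PowerSeries.C a * F) (fun t => a * f t) := (const a).mul h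

theorem id_mul (h : HasTaylor F f) : HasTaylor (PowerSeries.X * F) (fun t => t * f t) := id.mul h

theorem deriv (h : HasTaylor F f) : HasTaylor (PowerSeries.derivative ℂ F) (deriv f) := by
  have h1 := of_analyticAt h.analyticAt.deriv
  convert! h1 using 1
  ext n
  rw [PowerSeries.coeff_derivative, PowerSeries.coeff_mk, h.coeff_eq, iteratedDeriv_succ',
    Nat.factorial_succ]
  have : (n : ℂ) + 1 ≠ 0 := by exact_mod_cast n.succ_ne_zero
  have : (n.factorial : ℂ) ≠ 0 := by exact_mod_cast n.factorial_ne_zero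
  push_cast
  field_simp

/-- A relation between analytic germs that holds off the centre holds at the centre, hence for the
Taylor series. -/
theorem eq_of_punctured (h : HasTaylor F f) (h' : HasTaylor G g)
    (he : ∀ᶠ t in 𝓝[≠] (0 : ℂ), f t = g t) : F = G :=
  h.unique_left (h'.congr
    ((h'.analyticAt.frequently_eq_iff_eventually_eq h.analyticAt).1
      (he.mono fun _ h => h.symm).frequently))

end HasTaylor

/-- The Euler operator `X d/dX` multiplies the `n`-th coefficient by `n`. -/
theorem PowerSeries.coeff_X_mul_derivative (F : PowerSeries ℂ) (n : ℕ) :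
    coeff n (X * derivative ℂ F) = n * coeff n F := by
  cases n with
  | zero => simp
  | succ n => rw [coeff_succ_X_mul, coeff_derivative]; push_cast; ring

theorem PowerSeries.coeff_X_mul_X_mul_derivative_derivative (F : PowerSeries ℂ) (n : ℕ) :
    coeff n (X * (X * derivative ℂ (derivative ℂ F))) = n * (n - 1) * coeff n F := by
  cases n with
  | zero => simp
  | succ n => rw [coeff_succ_X_mul, coeff_X_mul_derivative, coeff_derivative]; push_cast; ring

/-! ### The three-term recurrence of the weighted Gegenbauer polynomials -/

theorem gegenbauer_hasTaylor (l x : ℂ) :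
    HasTaylor (PowerSeries.mk fun n => (gegenbauer l n).eval x)
      (fun t => (1 - 2 * x * t + t ^ 2) ^ (-l)) := by
  have hc : Continuous fun t : ℂ => 2 * ‖x‖ * ‖t‖ + ‖t‖ ^ 2 := by fun_prop
  have h0 : ∀ᶠ t in 𝓝 (0 : ℂ), 2 * ‖x‖ * ‖t‖ + ‖t‖ ^ 2 < 1 :=
    hc.continuousAt.eventually_lt_const (by simp)
  filter_upwards [h0] with t ht
  simpa using gegenbauer_hasSum l x t ht

theorem eventually_sq_mem_slitPlane (x : ℂ) :
    ∀ᶠ t in 𝓝 (0 : ℂ), 1 - 2 * x * t + t ^ 2 ∈ Complex.slitPlane := by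
  have hc : Continuous fun t : ℂ => 1 - 2 * x * t + t ^ 2 := by fun_prop
  exact hc.continuousAt.eventually_mem (Complex.isOpen_slitPlane.mem_nhds (by simp))

theorem gegenbauer_zero (l : ℂ) : gegenbauer l 0 = 1 := by
  simp [gegenbauer, poch]

/-- The three-term recurrence of the Gegenbauer polynomials, read off from the differential equation
`(1 - 2xt + t²) g' = 2l (x - t) g` of their generating function. -/
theorem gegenbauer_recurrence (l x : ℂ) :
    (gegenbauer l 1).eval x = 2 * l * x ∧ ∀ n : ℕ,
    ((n : ℂ) + 2) * (gegenbauer l (n + 2)).eval x =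
      2 * (n + 1 + l) * x * (gegenbauer l (n + 1)).eval x
        - (n + 2 * l) * (gegenbauer l n).eval x := by
  set F : PowerSeries ℂ := PowerSeries.mk fun n => (gegenbauer l n).eval x with hF
  have hT : HasTaylor F _ := gegenbauer_hasTaylor l x
  have hD := hT.deriv
  have key : PowerSeries.derivative ℂ F + (PowerSeries.C (-2 * x) * (PowerSeries.X *
        PowerSeries.derivative ℂ F) + PowerSeries.X * (PowerSeries.X * PowerSeries.derivative ℂ F))
      = PowerSeries.C (2 * l * x) * F + PowerSeries.C (-2 * l) * (PowerSeries.X * F) := by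
    refine (hD.add ((hD.id_mul.const_mul _).add hD.id_mul.id_mul)).unique_left
      (((hT.const_mul _).add (hT.id_mul.const_mul _)).congr ?_)
    filter_upwards [eventually_sq_mem_slitPlane x] with t ht
    have h0 := Complex.slitPlane_ne_zero ht
    have hp : HasDerivAt (fun t : ℂ => 1 - 2 * x * t + t ^ 2) (-(2 * x) + 2 * t) t := by
      have := (((hasDerivAt_id t).const_mul (2 * x)).const_sub 1).add ((hasDerivAt_id t).pow 2)
      convert! this using 1
      simp
    rw [(hp.cpow_const ht).deriv, Complex.cpow_sub _ _ h0, Complex.cpow_one]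
    field_simp
    ring
  have h1 := congrArg (PowerSeries.coeff 0) key
  simp only [map_add, PowerSeries.coeff_C_mul, PowerSeries.coeff_zero_X_mul,
    PowerSeries.coeff_derivative] at h1
  simp only [hF, PowerSeries.coeff_mk, gegenbauer_zero] at h1
  refine ⟨by simpa using h1, fun n => ?_⟩
  have h2 := congrArg (PowerSeries.coeff (n + 1)) key
  simp only [map_add, PowerSeries.coeff_C_mul, PowerSeries.coeff_succ_X_mul,
    PowerSeries.coeff_X_mul_derivative] at h2
  simp only [hF, PowerSeries.coeff_mk, PowerSeries.coeff_derivative] at h2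
  push_cast at h2
  linear_combination h2

/-- The specialisation at `x` of the generating function. -/
noncomputable def genFunAt (x : ℂ) : PowerSeries ℂ :=
  PowerSeries.mk fun n => coeff16 n * (gegenbauer (1 / 6) n).eval x

theorem poch_succ (a : ℂ) (n : ℕ) : poch a (n + 1) = poch a n * (a + n) := by
  simp [poch, ascPochhammer_succ_eval]

theorem coeff16_zero : coeff16 0 = 1 := by simp [coeff16, poch]

theorem coeff16_succ (n : ℕ) :
    ((n : ℂ) + 1 / 3) * coeff16 (n + 1) = ((n : ℂ) - 1 / 12) * coeff16 n := by
  have h : ∀ m : ℕ, (1 / 3 + m : ℂ) ≠ 0 := fun m hm => by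
    have h3 := congrArg Complex.re hm
    simp only [Complex.add_re, Complex.natCast_re, Complex.zero_re] at h3
    norm_num at h3
    have : (0 : ℝ) ≤ m := m.cast_nonneg
    linarith
  have h2 : ∀ m : ℕ, poch (1 / 3) m ≠ 0 := fun m => by
    induction m with
    | zero => simp [poch]
    | succ m ih => rw [poch_succ]; exact mul_ne_zero ih (h m)
  rw [coeff16, coeff16, poch_succ, poch_succ, add_comm (n : ℂ)]
  rw [mul_div_assoc', mul_div_assoc', div_eq_div_iff (mul_ne_zero (h2 n) (h n)) (h2 n)]
  ring

theorem coeff_zero_genFunAt (x : ℂ) : PowerSeries.coeff 0 (genFunAt x) = 1 := by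
  simp [genFunAt, coeff16_zero, gegenbauer_zero]

theorem coeff_one_genFunAt (x : ℂ) : PowerSeries.coeff 1 (genFunAt x) = -x / 12 := by
  have h := coeff16_succ 0
  rw [coeff16_zero] at h
  rw [genFunAt, PowerSeries.coeff_mk, (gegenbauer_recurrence _ x).1]
  push_cast at h
  linear_combination x * h

/-- The factor `n + 2l`, here `n + 1/3`, of the Gegenbauer recurrence cancels against the
denominators `(1/3)_n`, so the weighted coefficients again satisfy a three-term recurrence. -/
theorem coeff_genFunAt_recurrence (x : ℂ) (n : ℕ) :
    ((n : ℂ) + 2) * (n + 4 / 3) * PowerSeries.coeff (n + 2) (genFunAt x) =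
      2 * (n + 7 / 6) * (n + 11 / 12) * x * PowerSeries.coeff (n + 1) (genFunAt x)
        - (n + 11 / 12) * (n - 1 / 12) * PowerSeries.coeff n (genFunAt x) := by
  have h0 := coeff16_succ n
  have h1 := coeff16_succ (n + 1)
  have hg := (gegenbauer_recurrence (1 / 6) x).2 n
  simp only [genFunAt, PowerSeries.coeff_mk]
  push_cast at h1
  linear_combination ((n : ℂ) + 4 / 3) * coeff16 (n + 2) * hg +
    (2 * (n + 1 + 1 / 6) * x * (gegenbauer (1 / 6) (n + 1)).eval x
        - (n + 2 * (1 / 6)) * (gegenbauer (1 / 6) n).eval x) * h1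
    - (n + 11 / 12) * (gegenbauer (1 / 6) n).eval x * h0

/-! ### The tetrahedral hypergeometric function -/

/-- `s(y) = ((1 + y + y²) / 3)^(1/2)`. -/
noncomputable def tetraRoot (y : ℂ) : ℂ := ((1 + y + y ^ 2) / 3) ^ (1 / 2 : ℂ)

/-- `h_e(y) = s(y) + e (1 + y) / 2`. -/
noncomputable def tetraBase (e y : ℂ) : ℂ := tetraRoot y + e * ((1 + y) / 2)

/-- The fourth root of `h_e(y)`. -/
noncomputable def tetraBranch (e y : ℂ) : ℂ := tetraBase e y ^ (1 / 4 : ℂ)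

/-- The combination of the two branches that is a function of `y ^ 3`. -/
noncomputable def tetraSum (y : ℂ) : ℂ :=
  const16 * ((√(√3 + 1) : ℝ) * tetraBranch 1 y + (√(√3 - 1) : ℝ) * tetraBranch (-1) y)

theorem tetraRoot_sq (y : ℂ) : tetraRoot y ^ 2 = (1 + y + y ^ 2) / 3 := by
  rw [tetraRoot, ← Complex.cpow_nat_mul]; norm_num

theorem tetraRoot_zero : tetraRoot 0 = ((1 / √3 : ℝ) : ℂ) := by
  rw [tetraRoot, show ((1 + 0 + 0 ^ 2) / 3 : ℂ) = ((1 / 3 : ℝ) : ℂ) by norm_num,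
    show (1 / 2 : ℂ) = ((1 / 2 : ℝ) : ℂ) by norm_num, ← Complex.ofReal_cpow (by norm_num),
    ← Real.sqrt_eq_rpow, Real.sqrt_div' _ (by norm_num), Real.sqrt_one]

theorem tetraBase_zero (e : ℝ) : tetraBase e 0 = ((1 / √3 + e / 2 : ℝ) : ℂ) := by
  rw [tetraBase, tetraRoot_zero]; push_cast; ring

theorem one_div_sqrt_three_add_pos {e : ℝ} (he : e ^ 2 = 1) : 0 < 1 / √3 + e / 2 := by
  have h3 : √3 < 2 := by rw [Real.sqrt_lt' (by norm_num)]; norm_num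
  have h : (1 / 2 : ℝ) < 1 / √3 := by
    apply one_div_lt_one_div_of_lt (by positivity) h3
  nlinarith

theorem eventually_mem_slitPlane_tetraRoot :
    ∀ᶠ y in 𝓝 (0 : ℂ), (1 + y + y ^ 2) / 3 ∈ Complex.slitPlane := by
  have hc : Continuous fun y : ℂ => (1 + y + y ^ 2) / 3 := by fun_prop
  refine hc.continuousAt.eventually_mem (Complex.isOpen_slitPlane.mem_nhds ?_)
  norm_num [Complex.mem_slitPlane_iff]

theorem hasDerivAt_tetraRoot {y : ℂ} (hy : (1 + y + y ^ 2) / 3 ∈ Complex.slitPlane) :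
    HasDerivAt tetraRoot ((1 + 2 * y) / (6 * tetraRoot y)) y := by
  have hp : HasDerivAt (fun y : ℂ => (1 + y + y ^ 2) / 3) ((1 + 2 * y) / 3) y := by
    have := (((hasDerivAt_id y).const_add 1).add ((hasDerivAt_id y).pow 2)).div_const 3
    convert! this using 1
    simp
  have h0 := Complex.slitPlane_ne_zero hy
  have h2 := tetraRoot_sq y
  have h1 : tetraRoot y ≠ 0 := fun h => h0 (by rw [← h2, h]; ring)
  have h3 := hp.cpow_const (c := 1 / 2) hy
  rw [Complex.cpow_sub _ _ h0, Complex.cpow_one, ← h2] at h3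
  rw [show (tetraRoot y ^ 2) ^ (1 / 2 : ℂ) = tetraRoot y by rw [h2]; rfl] at h3
  convert! h3 using 1
  field_simp
  ring

theorem continuousAt_tetraRoot {y : ℂ} (hy : (1 + y + y ^ 2) / 3 ∈ Complex.slitPlane) :
    ContinuousAt tetraRoot y := (hasDerivAt_tetraRoot hy).continuousAt

theorem eventually_mem_slitPlane_tetraBase {e : ℝ} (he : e ^ 2 = 1) :
    ∀ᶠ y in 𝓝 (0 : ℂ), tetraBase e y ∈ Complex.slitPlane := by
  have hc : ContinuousAt (tetraBase e) 0 :=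
    (continuousAt_tetraRoot eventually_mem_slitPlane_tetraRoot.self_of_nhds).add
      (by fun_prop)
  refine hc.eventually_mem (Complex.isOpen_slitPlane.mem_nhds ?_)
  rw [tetraBase_zero]
  exact Complex.ofReal_mem_slitPlane.2 (one_div_sqrt_three_add_pos he)

/-- The logarithmic derivative of `h_e` simplifies because `h₊ h₋ = (1 - y)² / 12`. -/
theorem hasDerivAt_tetraBranch {e y : ℂ} (he : e ^ 2 = 1)
    (hy : (1 + y + y ^ 2) / 3 ∈ Complex.slitPlane) (hb : tetraBase e y ∈ Complex.slitPlane)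
    (hy1 : y ≠ 1) :
    HasDerivAt (tetraBranch e)
      (tetraBranch e y * ((e / tetraRoot y - 1) / (4 * (1 - y)))) y := by
  have h2 := tetraRoot_sq y
  have h1 : tetraRoot y ≠ 0 := fun h => Complex.slitPlane_ne_zero hy (by rw [← h2, h]; ring)
  have h0 := Complex.slitPlane_ne_zero hb
  have h3 : 1 - y ≠ 0 := sub_ne_zero.2 hy1.symm
  have hl : HasDerivAt (fun y : ℂ => e * ((1 + y) / 2)) (e * (1 / 2)) y :=
    (((hasDerivAt_id y).const_add 1).div_const 2).const_mul e
  have hd : HasDerivAt (tetraBase e) ((1 + 2 * y) / (6 * tetraRoot y) + e * (1 / 2)) y :=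
    (hasDerivAt_tetraRoot hy).add hl
  have h4 := hd.cpow_const (c := 1 / 4) hb
  rw [Complex.cpow_sub _ _ h0, Complex.cpow_one] at h4
  have hlog : ((1 + 2 * y) / (6 * tetraRoot y) + e * (1 / 2)) =
      tetraBase e y * ((e / tetraRoot y - 1) / (1 - y)) := by
    have h5 : tetraBase e y = tetraRoot y + e * ((1 + y) / 2) := rfl
    rw [h5]
    field_simp
    linear_combination (-6 * (1 + y)) * he + 12 * h2
  rw [hlog] at h4
  refine h4.congr_deriv ?_
  simp only [tetraBranch]
  field_simp

theorem eventually_hasDerivAt_tetraBranch {e : ℝ} (he : e ^ 2 = 1) :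
    ∀ᶠ y in 𝓝 (0 : ℂ), tetraRoot y ≠ 0 ∧ y ≠ 1 ∧
      HasDerivAt tetraRoot ((1 + 2 * y) / (6 * tetraRoot y)) y ∧
      HasDerivAt (tetraBranch e)
        (tetraBranch e y * ((e / tetraRoot y - 1) / (4 * (1 - y)))) y := by
  filter_upwards [eventually_mem_slitPlane_tetraRoot, eventually_mem_slitPlane_tetraBase he,
    eventually_ne_nhds zero_ne_one] with y h1 h2 h3
  refine ⟨fun h => Complex.slitPlane_ne_zero h1 (by rw [← tetraRoot_sq, h]; ring), h3,
    hasDerivAt_tetraRoot h1, hasDerivAt_tetraBranch (by exact_mod_cast he) h1 h2 h3⟩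

theorem analyticAt_tetraBranch {e : ℝ} (he : e ^ 2 = 1) : AnalyticAt ℂ (tetraBranch e) 0 := by
  rw [Complex.analyticAt_iff_eventually_differentiableAt]
  filter_upwards [eventually_hasDerivAt_tetraBranch he] with y hy
  exact hy.2.2.2.differentiableAt

/-- The differential equation common to the two branches. -/
theorem eventually_deriv_deriv_tetraBranch {e : ℝ} (he : e ^ 2 = 1) :
    ∀ᶠ y in 𝓝 (0 : ℂ), (1 - y ^ 3) * deriv (deriv (tetraBranch e)) y =
      3 / 2 * (y * (y * deriv (tetraBranch e) y)) - 3 / 16 * (y * tetraBranch e y) := by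
  have hev := eventually_hasDerivAt_tetraBranch he
  filter_upwards [hev, hev.eventually_nhds] with y ⟨h0, h1, hr, hb⟩ hev
  have hd : deriv (tetraBranch e) =ᶠ[𝓝 y]
      fun y => tetraBranch e y * ((e / tetraRoot y - 1) / (4 * (1 - y))) :=
    hev.mono fun z hz => hz.2.2.2.deriv
  have h3 : 1 - y ≠ 0 := sub_ne_zero.2 h1.symm
  have h2 := tetraRoot_sq y
  have he' : (e : ℂ) ^ 2 = 1 := by exact_mod_cast he
  have hq : HasDerivAt (fun y => ((e : ℂ) / tetraRoot y - 1) / (4 * (1 - y)))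
      (((0 * tetraRoot y - e * ((1 + 2 * y) / (6 * tetraRoot y))) / tetraRoot y ^ 2 * (4 * (1 - y))
        - (e / tetraRoot y - 1) * (4 * -1)) / (4 * (1 - y)) ^ 2) y :=
    (((hasDerivAt_const y (e : ℂ)).div hr h0).sub_const 1).div
      (((hasDerivAt_id y).const_sub 1).const_mul 4) (mul_ne_zero (by norm_num) h3)
  have hbq := (hb.mul hq).deriv
  rw [hd.deriv_eq, hb.deriv]
  refine (congrArg _ hbq).trans ?_
  generalize tetraBranch e y = b
  generalize tetraRoot y = s at *
  generalize (e : ℂ) = e at *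
  field_simp
  -- Only `e² = 1` and `3 s² = 1 + y + y²` are used, with `1 - y³ = (1 - y) (1 + y + y²)`.
  linear_combination 192 * (1 - y ^ 3) * b * s * he' +
    (32 * (1 - y ^ 3) * b * (12 * e - 18 * s)
      - 72 * y * b * (1 - y) * (16 * y * e - 8 * s - 8 * y * s)) * h2

/-- At `y = 0` the base `1/√3 + e/2` equals `(√3 + e)² / (4√3)`. -/
theorem tetraBranch_zero {e : ℝ} (he : e ^ 2 = 1) :
    tetraBranch e 0 = ((√(√3 + e) / (√2 * 3 ^ (1 / 8 : ℝ)) : ℝ) : ℂ) := by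
  have hpos := one_div_sqrt_three_add_pos he
  rw [tetraBranch, tetraBase_zero, show (1 / 4 : ℂ) = ((1 / 4 : ℝ) : ℂ) by norm_num,
    ← Complex.ofReal_cpow hpos.le]
  congr 1
  have h3 : √3 ^ 2 = 3 := Real.sq_sqrt (by norm_num)
  have h30 : 0 < √3 := by positivity
  have he1 : 0 < √3 + e := by
    have : 1 < √3 := by rw [Real.lt_sqrt (by norm_num)]; norm_num
    nlinarith
  have h4 : (√(√3 + e) / (√2 * 3 ^ (1 / 8 : ℝ))) ^ 4 = 1 / √3 + e / 2 := by
    have h8 : ((3 : ℝ) ^ (1 / 8 : ℝ)) ^ 4 = √3 := by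
      rw [← Real.rpow_mul_natCast (by norm_num), Real.sqrt_eq_rpow]; norm_num
    rw [div_pow, mul_pow, h8, show √(√3 + e) ^ 4 = (√(√3 + e) ^ 2) ^ 2 by ring,
      show √2 ^ 4 = (√2 ^ 2) ^ 2 by ring, Real.sq_sqrt he1.le, Real.sq_sqrt (by norm_num)]
    field_simp
    linear_combination he + (1 : ℝ) * h3
  rw [← h4, ← Real.rpow_natCast, ← Real.rpow_mul (by positivity)]
  norm_num

/-- The value that normalises the generating function to `1` at `t = 0`, where `p = 2`. -/
theorem const16_mul_eq :
    const16 * (√(√3 + 1) * (√(√3 + 1) / (√2 * 3 ^ (1 / 8 : ℝ))) +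
      √(√3 - 1) * (√(√3 - 1) / (√2 * 3 ^ (1 / 8 : ℝ)))) = 2 ^ (-1 / 12 : ℝ) := by
  have h1 : 1 < √3 := by rw [Real.lt_sqrt (by norm_num)]; norm_num
  have ha : √(√3 + 1) * √(√3 + 1) = √3 + 1 := Real.mul_self_sqrt (by linarith)
  have hb : √(√3 - 1) * √(√3 - 1) = √3 - 1 := Real.mul_self_sqrt (by linarith)
  rw [mul_div_assoc', mul_div_assoc', ha, hb, ← add_div, const16,
    show √3 + 1 + (√3 - 1) = 2 * √3 by ring, Real.sqrt_eq_rpow, Real.sqrt_eq_rpow]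
  rw [mul_div_assoc', div_eq_iff (by positivity)]
  have e2 : (2 : ℝ) ^ (-7 / 12 : ℝ) * 2 = 2 ^ (-1 / 12 : ℝ) * 2 ^ (1 / 2 : ℝ) := by
    rw [← Real.rpow_add (by norm_num), ← Real.rpow_add_one (by norm_num)]; norm_num
  have e3 : (3 : ℝ) ^ (-3 / 8 : ℝ) * 3 ^ (1 / 2 : ℝ) = 3 ^ (1 / 8 : ℝ) := by
    rw [← Real.rpow_add (by norm_num)]; norm_num
  calc _ = ((2 : ℝ) ^ (-7 / 12 : ℝ) * 2) * (3 ^ (-3 / 8 : ℝ) * 3 ^ (1 / 2 : ℝ)) := by ring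
    _ = _ := by rw [e2, e3, mul_assoc]

theorem tetraSum_zero : tetraSum 0 = ((2 ^ (-1 / 12 : ℝ) : ℝ) : ℂ) := by
  have h1 := tetraBranch_zero (e := 1) (by norm_num)
  have h2 := tetraBranch_zero (e := -1) (by norm_num)
  push_cast at h1 h2
  rw [tetraSum, h1, h2, ← const16_mul_eq]
  push_cast
  ring_nf

theorem hasTaylor_tetraBranch {e : ℝ} (he : e ^ 2 = 1) :
    ∃ F : PowerSeries ℂ, HasTaylor F (tetraBranch e) ∧
      PowerSeries.coeff 1 F = tetraBranch e 0 * ((e * √3 - 1) / 4) ∧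
      PowerSeries.coeff 2 F = 0 ∧ ∀ n : ℕ, ((n : ℂ) + 3) * (n + 2) * PowerSeries.coeff (n + 3) F =
        (n - 1 / 4) * (n + 3 / 4) * PowerSeries.coeff n F := by
  obtain ⟨F, hF⟩ : ∃ F, HasTaylor F (tetraBranch e) :=
    ⟨_, HasTaylor.of_analyticAt (analyticAt_tetraBranch he)⟩
  have hD := hF.deriv
  have key : PowerSeries.derivative ℂ (PowerSeries.derivative ℂ F) + PowerSeries.C (-1) *
        (PowerSeries.X * (PowerSeries.X * (PowerSeries.X *
          PowerSeries.derivative ℂ (PowerSeries.derivative ℂ F)))) =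
      PowerSeries.C (3 / 2) * (PowerSeries.X * (PowerSeries.X * PowerSeries.derivative ℂ F)) +
        PowerSeries.C (-3 / 16) * (PowerSeries.X * F) := by
    refine (hD.deriv.add (hD.deriv.id_mul.id_mul.id_mul.const_mul _)).unique_left
      (((hD.id_mul.id_mul.const_mul _).add (hF.id_mul.const_mul _)).congr ?_)
    filter_upwards [eventually_deriv_deriv_tetraBranch he] with y hy
    linear_combination -hy
  refine ⟨F, hF, ?_, ?_, fun n => ?_⟩
  · rw [hF.coeff_eq]
    obtain ⟨-, -, -, h⟩ := (eventually_hasDerivAt_tetraBranch he).self_of_nhds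
    rw [iteratedDeriv_one, h.deriv, tetraRoot_zero]
    push_cast
    simp
  · have h := congrArg (PowerSeries.coeff 0) key
    simp only [map_add, PowerSeries.coeff_C_mul, PowerSeries.coeff_zero_X_mul,
      PowerSeries.coeff_derivative] at h
    norm_num at h
    exact h
  · have h := congrArg (PowerSeries.coeff (n + 1)) key
    simp only [map_add, PowerSeries.coeff_C_mul, PowerSeries.coeff_succ_X_mul,
      PowerSeries.coeff_X_mul_derivative, PowerSeries.coeff_X_mul_X_mul_derivative_derivative,
      PowerSeries.coeff_derivative] at h
    push_cast at h
    linear_combination h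

/-- The function `tetraSum` depends on `y ^ 3` only: both branches solve the same differential
equation, whose coefficient recurrence has step three, and the weights are such that the
derivative of the sum vanishes at `0`. -/
theorem hasTaylor_tetraSum :
    ∃ F : PowerSeries ℂ, HasTaylor F tetraSum ∧
      (∀ n, PowerSeries.coeff (3 * n + 1) F = 0) ∧ (∀ n, PowerSeries.coeff (3 * n + 2) F = 0) ∧
      ∀ n : ℕ, ((n : ℂ) + 3) * (n + 2) * PowerSeries.coeff (n + 3) F =
        (n - 1 / 4) * (n + 3 / 4) * PowerSeries.coeff n F := by
  obtain ⟨F, hF, hF1, hF2, hFn⟩ := hasTaylor_tetraBranch (e := 1) (by norm_num)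
  obtain ⟨G, hG, hG1, hG2, hGn⟩ := hasTaylor_tetraBranch (e := -1) (by norm_num)
  set a : ℂ := ((√(√3 + 1) : ℝ) : ℂ) with ha0
  set b : ℂ := ((√(√3 - 1) : ℝ) : ℂ) with hb0
  have hrec : ∀ n : ℕ, ((n : ℂ) + 3) * (n + 2) * PowerSeries.coeff (n + 3)
        (PowerSeries.C (const16 : ℂ) * (PowerSeries.C a * F + PowerSeries.C b * G)) =
      (n - 1 / 4) * (n + 3 / 4) * PowerSeries.coeff n
        (PowerSeries.C (const16 : ℂ) * (PowerSeries.C a * F + PowerSeries.C b * G)) := fun n => by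
    simp only [PowerSeries.coeff_C_mul, map_add]
    linear_combination const16 * a * hFn n + const16 * b * hGn n
  have hpos : ∀ m : ℕ, ((m : ℂ) + 3) * (m + 2) ≠ 0 := fun m => by
    have : (m + 3) * (m + 2) ≠ 0 := by positivity
    exact_mod_cast this
  have hstep : ∀ k, PowerSeries.coeff k
        (PowerSeries.C (const16 : ℂ) * (PowerSeries.C a * F + PowerSeries.C b * G)) = 0 → ∀ n,
      PowerSeries.coeff (3 * n + k)
        (PowerSeries.C (const16 : ℂ) * (PowerSeries.C a * F + PowerSeries.C b * G)) = 0 := by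
    intro k hk n
    induction n with
    | zero => simpa using hk
    | succ n ih =>
      have h := hrec (3 * n + k)
      rw [ih, mul_zero] at h
      rw [show 3 * (n + 1) + k = 3 * n + k + 3 by ring]
      exact (mul_eq_zero.1 h).resolve_left (hpos _)
  refine ⟨PowerSeries.C (const16 : ℂ) * (PowerSeries.C a * F + PowerSeries.C b * G), ?_,
    hstep 1 ?_, hstep 2 ?_, hrec⟩
  · have h := ((hF.const_mul a).add (hG.const_mul b)).const_mul (const16 : ℂ)
    push_cast at h
    exact h
  · have h1 : 1 < √3 := by rw [Real.lt_sqrt (by norm_num)]; norm_num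
    have ha : a * a = √3 + 1 := by
      have := Real.mul_self_sqrt (show 0 ≤ √3 + 1 by linarith)
      rw [ha0, ← Complex.ofReal_mul, this]; push_cast; rfl
    have hb : b * b = √3 - 1 := by
      have := Real.mul_self_sqrt (show 0 ≤ √3 - 1 by linarith)
      rw [hb0, ← Complex.ofReal_mul, this]; push_cast; rfl
    rw [tetraBranch_zero (by norm_num)] at hF1 hG1
    simp only [PowerSeries.coeff_C_mul, map_add, hF1, hG1]
    rw [← sub_eq_add_neg]
    push_cast
    linear_combination (const16 : ℂ) / (√2 * ((3 ^ (1 / 8 : ℝ) : ℝ) : ℂ)) / 4 *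
      ((√3 - 1) * ha - (√3 + 1) * hb)
  · simp [hF2, hG2]

/-- A function `G` of `q` with `G (y ^ 3) = tetraSum y`, and its hypergeometric equation. -/
theorem exists_tetraHyp : ∃ G : ℂ → ℂ, AnalyticAt ℂ G 0 ∧
    (∀ᶠ y in 𝓝 (0 : ℂ), G (y ^ 3) = tetraSum y) ∧
    ∀ᶠ q in 𝓝 (0 : ℂ), q * (q * deriv (deriv G) q) + 2 / 3 * (q * deriv G q) =
      q * (q * (q * deriv (deriv G) q) + 7 / 6 * (q * deriv G q) - 1 / 48 * G q) := by
  obtain ⟨F, hF, h1, h2, hrec⟩ := hasTaylor_tetraSum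
  have hsum : ∀ y, HasSum (fun n => PowerSeries.coeff n F * y ^ n) (tetraSum y) →
      HasSum (fun n => PowerSeries.coeff (3 * n) F * (y ^ 3) ^ n) (tetraSum y) := fun y hy => by
    have hinj : Function.Injective fun n : ℕ => 3 * n := fun m n h => by simpa using h
    rw [← hinj.hasSum_iff] at hy
    · simpa [Function.comp_def, pow_mul] using hy
    · intro n hn
      have h3 : n % 3 ≠ 0 := fun h => hn ⟨n / 3, by dsimp only; omega⟩
      obtain h | h : n = 3 * (n / 3) + 1 ∨ n = 3 * (n / 3) + 2 := by omega
      · rw [h, h1, zero_mul]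
      · rw [h, h2, zero_mul]
  -- The values of `G` come from any cube root; the principal one is as good as any other.
  set G : ℂ → ℂ := fun q => tetraSum (q ^ (1 / 3 : ℂ))
  have hroot : ∀ q : ℂ, (q ^ (1 / 3 : ℂ)) ^ 3 = q := fun q => by
    rw [← Complex.cpow_nat_mul]; norm_num
  have hlim : Tendsto (fun q : ℂ => q ^ (1 / 3 : ℂ)) (𝓝 0) (𝓝 0) := by
    have := Complex.continuousAt_cpow_const_of_re_pos (z := 0) (w := 1 / 3) (by simp) (by norm_num)
    simpa [ContinuousAt] using this
  have hG : HasTaylor (PowerSeries.mk fun n => PowerSeries.coeff (3 * n) F) G := by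
    filter_upwards [hlim.eventually hF] with q hq
    have := hsum _ hq
    rw [hroot] at this
    simp only [PowerSeries.coeff_mk]
    exact this
  refine ⟨G, hG.analyticAt, ?_, ?_⟩
  · have hcube : Tendsto (fun y : ℂ => y ^ 3) (𝓝 0) (𝓝 0) := by
      have : Continuous fun y : ℂ => y ^ 3 := by fun_prop
      simpa using this.tendsto 0
    filter_upwards [hcube.eventually hG, hF] with y hy hy'
    refine hy.unique ?_
    simpa using hsum y hy'
  · have hD := hG.deriv
    have hl := hD.deriv.id_mul.id_mul.add (hD.id_mul.const_mul (2 / 3))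
    have hr := (hD.deriv.id_mul.id_mul.add ((hD.id_mul.const_mul (7 / 6)).add
      (hG.const_mul (-1 / 48)))).id_mul
    refine (hl.unique_right (g := fun q => q * (q * (q * deriv (deriv G) q) +
      (7 / 6 * (q * deriv G q) + -1 / 48 * G q))) ?_).mono fun q hq => hq.trans (by ring)
    · convert! hr using 1
      ext n
      cases n with
      | zero => simp only [map_add, PowerSeries.coeff_C_mul, PowerSeries.coeff_zero_X_mul]; ring
      | succ n =>
        simp only [map_add, PowerSeries.coeff_C_mul, PowerSeries.coeff_succ_X_mul,
          PowerSeries.coeff_X_mul_derivative,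
          PowerSeries.coeff_X_mul_X_mul_derivative_derivative, PowerSeries.coeff_derivative,
          PowerSeries.coeff_mk]
        have h := hrec (3 * n)
        push_cast at h
        rw [show 3 * (n + 1) = 3 * n + 3 by ring]
        linear_combination h / 9

/-! ### The closed form near `t = 0` -/

/-- `p = 1 - xt + R`. -/
noncomputable def gegenP (x t : ℂ) : ℂ := 1 - x * t + bigR x t

/-- `q = (1 - xt - R) / (1 - xt + R)`. -/
noncomputable def gegenQ (x t : ℂ) : ℂ := (1 - x * t - bigR x t) / gegenP x t

theorem bigR_sq (x t : ℂ) : bigR x t ^ 2 = 1 - 2 * x * t + t ^ 2 := by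
  rw [bigR, ← Complex.cpow_nat_mul]; norm_num

theorem bigR_zero (x : ℂ) : bigR x 0 = 1 := by simp [bigR]

theorem gegenP_zero (x : ℂ) : gegenP x 0 = 2 := by rw [gegenP, bigR_zero]; norm_num

theorem gegenQ_zero (x : ℂ) : gegenQ x 0 = 0 := by rw [gegenQ, bigR_zero]; simp

theorem analyticAt_bigR (x : ℂ) : AnalyticAt ℂ (bigR x) 0 := by
  have h : AnalyticAt ℂ (fun t : ℂ => 1 - 2 * x * t + t ^ 2) 0 := by fun_prop
  exact h.cpow analyticAt_const (eventually_sq_mem_slitPlane x).self_of_nhds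

theorem analyticAt_gegenP (x : ℂ) : AnalyticAt ℂ (gegenP x) 0 := by
  have h : AnalyticAt ℂ (fun t : ℂ => 1 - x * t) 0 := by fun_prop
  exact h.add (analyticAt_bigR x)

theorem analyticAt_gegenQ (x : ℂ) : AnalyticAt ℂ (gegenQ x) 0 := by
  have h : AnalyticAt ℂ (fun t : ℂ => 1 - x * t) 0 := by fun_prop
  refine (h.sub (analyticAt_bigR x)).div (analyticAt_gegenP x) ?_
  rw [gegenP_zero]; norm_num

theorem tendsto_gegenP (x : ℂ) : Tendsto (gegenP x) (𝓝 0) (𝓝 2) := by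
  simpa [ContinuousAt, gegenP_zero] using (analyticAt_gegenP x).continuousAt

theorem tendsto_gegenQ (x : ℂ) : Tendsto (gegenQ x) (𝓝 0) (𝓝 0) := by
  simpa [ContinuousAt, gegenQ_zero] using (analyticAt_gegenQ x).continuousAt

theorem eventually_gegenP_mem_slitPlane (x : ℂ) :
    ∀ᶠ t in 𝓝 (0 : ℂ), gegenP x t ∈ Complex.slitPlane :=
  (tendsto_gegenP x).eventually_mem (Complex.isOpen_slitPlane.mem_nhds
    (by norm_num [Complex.mem_slitPlane_iff]))

theorem hasDerivAt_bigR {x t : ℂ} (ht : 1 - 2 * x * t + t ^ 2 ∈ Complex.slitPlane) :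
    HasDerivAt (bigR x) ((t - x) / bigR x t) t := by
  have h0 := Complex.slitPlane_ne_zero ht
  have hp : HasDerivAt (fun t : ℂ => 1 - 2 * x * t + t ^ 2) (-(2 * x) + 2 * t) t := by
    have := (((hasDerivAt_id t).const_mul (2 * x)).const_sub 1).add ((hasDerivAt_id t).pow 2)
    convert! this using 1
    simp
  have h2 := bigR_sq x t
  have h1 : bigR x t ≠ 0 := fun h => h0 (by rw [← h2, h]; ring)
  have h3 := hp.cpow_const (c := 1 / 2) ht
  rw [Complex.cpow_sub _ _ h0, Complex.cpow_one, ← h2] at h3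
  rw [show (bigR x t ^ 2) ^ (1 / 2 : ℂ) = bigR x t by rw [h2]; rfl] at h3
  refine h3.congr_deriv ?_
  field_simp
  ring

/-- In terms of the logarithmic derivative, `t p' / p = 1 - 1 / R`. -/
theorem hasDerivAt_gegenP {x t : ℂ} (ht : 1 - 2 * x * t + t ^ 2 ∈ Complex.slitPlane)
    (ht0 : t ≠ 0) :
    HasDerivAt (gegenP x) (gegenP x t * ((1 - 1 / bigR x t) / t)) t := by
  have h2 := bigR_sq x t
  have h1 : bigR x t ≠ 0 := fun h => Complex.slitPlane_ne_zero ht (by rw [← h2, h]; ring)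
  have h3 : HasDerivAt (fun t => 1 - x * t) (-(x * 1)) t :=
    ((hasDerivAt_id t).const_mul x).const_sub 1
  refine (h3.add (hasDerivAt_bigR ht)).congr_deriv ?_
  rw [gegenP]
  field_simp
  linear_combination -h2

/-- In terms of the logarithmic derivative, `t q' / q = 2 / R`. -/
theorem hasDerivAt_gegenQ {x t : ℂ} (ht : 1 - 2 * x * t + t ^ 2 ∈ Complex.slitPlane)
    (ht0 : t ≠ 0) (hp : gegenP x t ≠ 0) :
    HasDerivAt (gegenQ x) (2 * gegenQ x t / (t * bigR x t)) t := by
  have h2 := bigR_sq x t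
  have h1 : bigR x t ≠ 0 := fun h => Complex.slitPlane_ne_zero ht (by rw [← h2, h]; ring)
  have h3 : HasDerivAt (fun t => 1 - x * t) (-(x * 1)) t :=
    ((hasDerivAt_id t).const_mul x).const_sub 1
  refine ((h3.sub (hasDerivAt_bigR ht)).div (hasDerivAt_gegenP ht ht0) hp).congr_deriv ?_
  simp only [gegenQ, Pi.sub_apply]
  field_simp
  linear_combination h2

theorem one_sub_gegenQ {x t : ℂ} (hp : gegenP x t ≠ 0) :
    1 - gegenQ x t = 2 * bigR x t / gegenP x t := by
  rw [gegenQ]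
  field_simp
  rw [gegenP]
  ring

/-- The differential equation of the generating function, in terms of the values `G`, `D = q G'`,
`E = q² G''` and of the Euler derivatives. -/
theorem euler_equation_aux {x t R p q G D E : ℂ} (hR : R ^ 2 = 1 - 2 * x * t + t ^ 2)
    (hR0 : R ≠ 0) (hp0 : p ≠ 0) (hp : p = 1 - x * t + R) (hq : q = (1 - x * t - R) / p)
    (hE : E + 2 / 3 * D = q * (E + 7 / 6 * D - 1 / 48 * G)) :
    R ^ 2 * (((1 - 1 / R) / 12 * ((1 - 1 / R) / 12) - (1 - 1 / R) / 12 + t * (t - x) / R / (12 * R ^ 2))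
        * G + (2 * ((1 - 1 / R) / 12) * (2 / R) - 2 / R - 2 * (t * (t - x) / R) / R ^ 2 + (2 / R) ^ 2)
        * D + (2 / R) ^ 2 * E) +
      ((1 - 1 / R) / 12 * G + 2 / R * D) * (1 / 3 - 13 / 6 * (x * t) + 11 / 6 * t ^ 2) +
      G * (x * t / 36 - 11 / 144 * t ^ 2) = 0 := by
  have hE' : 2 * R * E = -(2 / 3) * p * D + (1 - x * t - R) * (7 / 6 * D - 1 / 48 * G) := by
    rw [hq] at hE
    field_simp at hE
    rw [hp] at hE ⊢
    linear_combination hE / 864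
  have hE2 : E = (-(2 / 3) * p * D + (1 - x * t - R) * (7 / 6 * D - 1 / 48 * G)) / (2 * R) := by
    rw [eq_div_iff (by simpa using hR0)]
    linear_combination hE'
  rw [hE2, hp]
  field_simp
  linear_combination (44789760 * G - 49268736 * R * G - 1074954240 * D) * hR

/-- The leading factor `(n + 2) (n + 4/3)` never vanishes, so the recurrence determines the series. -/
theorem genFunAt_unique {x : ℂ} {F : PowerSeries ℂ} (h0 : PowerSeries.coeff 0 F = 1)
    (h1 : PowerSeries.coeff 1 F = -x / 12) (h : ∀ n : ℕ,
      ((n : ℂ) + 2) * (n + 4 / 3) * PowerSeries.coeff (n + 2) F =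
      2 * (n + 7 / 6) * (n + 11 / 12) * x * PowerSeries.coeff (n + 1) F
        - (n + 11 / 12) * (n - 1 / 12) * PowerSeries.coeff n F) : F = genFunAt x := by
  ext n
  induction n using Nat.twoStepInduction with
  | zero => rw [h0, coeff_zero_genFunAt]
  | one => rw [h1, coeff_one_genFunAt]
  | more n ih ih' =>
    have hne : ((n : ℂ) + 2) * (n + 4 / 3) ≠ 0 := by
      have : (n + 2) * (3 * n + 4) ≠ 0 := by positivity
      have h' : ((n : ℂ) + 2) * (3 * n + 4) ≠ 0 := by exact_mod_cast this
      intro h''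
      apply h'
      linear_combination 3 * h''
    apply mul_left_cancel₀ hne
    rw [h, coeff_genFunAt_recurrence, ih, ih']

section

variable {x : ℂ} {G : ℂ → ℂ}

theorem eventually_hasDerivAt_product (x : ℂ) (hG : AnalyticAt ℂ G 0) :
    ∀ᶠ t in 𝓝[≠] (0 : ℂ), HasDerivAt (fun t => gegenP x t ^ (1 / 12 : ℂ) * G (gegenQ x t))
      (gegenP x t ^ (1 / 12 : ℂ) * ((1 - 1 / bigR x t) / t / 12 * G (gegenQ x t) +
        2 * gegenQ x t / (t * bigR x t) * deriv G (gegenQ x t))) t := by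
  have hG' := (tendsto_gegenQ x).eventually hG.eventually_analyticAt
  filter_upwards [(eventually_gegenP_mem_slitPlane x).filter_mono nhdsWithin_le_nhds,
    (eventually_sq_mem_slitPlane x).filter_mono nhdsWithin_le_nhds,
    hG'.filter_mono nhdsWithin_le_nhds, self_mem_nhdsWithin] with t hp hR hGt ht0
  have hp0 := Complex.slitPlane_ne_zero hp
  have h1 := (hasDerivAt_gegenP hR ht0).cpow_const (c := 1 / 12) hp
  have h2 := hGt.differentiableAt.hasDerivAt.comp t (hasDerivAt_gegenQ hR ht0 hp0)
  refine (h1.mul h2).congr_deriv ?_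
  rw [Complex.cpow_sub _ _ hp0, Complex.cpow_one]
  simp only [Function.comp]
  field_simp

/-- The equation is stated off `t = 0`, where the logarithmic derivatives of `p` and `q` have a
removable singularity. -/
theorem eventually_euler_equation (x : ℂ) (hG : AnalyticAt ℂ G 0)
    (hode : ∀ᶠ q in 𝓝 (0 : ℂ), q * (q * deriv (deriv G) q) + 2 / 3 * (q * deriv G q) =
      q * (q * (q * deriv (deriv G) q) + 7 / 6 * (q * deriv G q) - 1 / 48 * G q)) {T : ℂ → ℂ}
    (hT : T = fun t => gegenP x t ^ (1 / 12 : ℂ) * G (gegenQ x t)) :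
    ∀ᶠ t in 𝓝[≠] (0 : ℂ), (1 - 2 * x * t + t ^ 2) * (t * (t * deriv (deriv T) t)) +
      (1 / 3 - 13 / 6 * (x * t) + 11 / 6 * t ^ 2) * (t * deriv T t) +
      (x * t / 36 - 11 / 144 * t ^ 2) * T t = 0 := by
  have hG' := (tendsto_gegenQ x).eventually hG.eventually_analyticAt
  have hode' := (tendsto_gegenQ x).eventually hode
  have hev := eventually_hasDerivAt_product x hG
  rw [← hT] at hev
  filter_upwards [(eventually_gegenP_mem_slitPlane x).filter_mono nhdsWithin_le_nhds,
    (eventually_sq_mem_slitPlane x).filter_mono nhdsWithin_le_nhds,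
    hG'.filter_mono nhdsWithin_le_nhds, hode'.filter_mono nhdsWithin_le_nhds, hev,
    eventually_eventually_nhdsWithin.2 hev, self_mem_nhdsWithin]
    with t hp hR hGt hodet hDt hevt ht0
  have ht1 : t ≠ 0 := ht0
  have hp0 := Complex.slitPlane_ne_zero hp
  have hsq := bigR_sq x t
  have hR0 : bigR x t ≠ 0 := fun h => Complex.slitPlane_ne_zero hR (by rw [← hsq, h]; ring)
  have hnhds : ∀ᶠ s in 𝓝 t, deriv T s = gegenP x s ^ (1 / 12 : ℂ) *
      ((1 - 1 / bigR x s) / s / 12 * G (gegenQ x s) +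
        2 * gegenQ x s / (s * bigR x s) * deriv G (gegenQ x s)) := by
    rw [isOpen_compl_singleton.nhdsWithin_eq ht0] at hevt
    exact hevt.mono fun s hs => hs.deriv
  have dR := hasDerivAt_bigR hR
  have dQ := hasDerivAt_gegenQ hR ht0 hp0
  have dP := (hasDerivAt_gegenP hR ht0).cpow_const (c := 1 / 12) hp
  have dG := hGt.differentiableAt.hasDerivAt.comp t dQ
  have dG' := hGt.deriv.differentiableAt.hasDerivAt.comp t dQ
  have dA := ((((hasDerivAt_const t (1 : ℂ)).div dR hR0).const_sub 1).div (hasDerivAt_id t)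
    ht0).div_const 12
  have dB := (dQ.const_mul 2).div ((hasDerivAt_id t).mul dR) (mul_ne_zero ht0 hR0)
  have hD2 := dP.mul ((dA.mul dG).add (dB.mul dG'))
  have hDD := (EventuallyEq.deriv_eq hnhds).trans hD2.deriv
  rw [hDD, hDt.deriv, hT]
  rw [Complex.cpow_sub _ _ hp0, Complex.cpow_one]
  simp only [Function.comp, Pi.div_apply, Pi.mul_apply, Pi.add_apply, id]
  have key := euler_equation_aux (G := G (gegenQ x t)) (D := gegenQ x t * deriv G (gegenQ x t))
    (E := gegenQ x t * (gegenQ x t * deriv (deriv G) (gegenQ x t))) hsq hR0 hp0 rfl rfl hodet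
  rw [← hsq]
  linear_combination (norm := skip) gegenP x t ^ (1 / 12 : ℂ) * key
  generalize gegenP x t ^ (1 / 12 : ℂ) = α
  generalize gegenP x t = p at *
  generalize deriv (deriv G) (gegenQ x t) = G2
  generalize deriv G (gegenQ x t) = G1
  generalize G (gegenQ x t) = G0
  generalize gegenQ x t = q
  generalize bigR x t = R at *
  field_simp
  ring

/-- The product `p^(1/12) G(q)` and the generating function have the same Taylor coefficients,
because they solve the same equation, which has a single analytic solution with given value
at `0`. -/
theorem genFunAt_hasTaylor (x : ℂ) (hG : AnalyticAt ℂ G 0)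
    (hG0 : G 0 = ((2 ^ (-1 / 12 : ℝ) : ℝ) : ℂ))
    (hode : ∀ᶠ q in 𝓝 (0 : ℂ), q * (q * deriv (deriv G) q) + 2 / 3 * (q * deriv G q) =
      q * (q * (q * deriv (deriv G) q) + 7 / 6 * (q * deriv G q) - 1 / 48 * G q)) :
    HasTaylor (genFunAt x) (fun t => gegenP x t ^ (1 / 12 : ℂ) * G (gegenQ x t)) := by
  set T : ℂ → ℂ := fun t => gegenP x t ^ (1 / 12 : ℂ) * G (gegenQ x t) with hT
  have hTan : AnalyticAt ℂ T 0 := by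
    refine ((analyticAt_gegenP x).cpow analyticAt_const
      (eventually_gegenP_mem_slitPlane x).self_of_nhds).mul ?_
    refine AnalyticAt.comp ?_ (analyticAt_gegenQ x)
    rwa [gegenQ_zero]
  obtain ⟨F, hF⟩ : ∃ F, HasTaylor F T := ⟨_, HasTaylor.of_analyticAt hTan⟩
  have hD := hF.deriv
  have h0 : PowerSeries.coeff 0 F = 1 := by
    rw [hF.coeff_eq, iteratedDeriv_zero, hT]
    simp only [gegenP_zero, gegenQ_zero, hG0, Nat.factorial_zero, Nat.cast_one, div_one]
    rw [show (2 : ℂ) ^ (1 / 12 : ℂ) = ((2 ^ (1 / 12 : ℝ) : ℝ) : ℂ) by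
      rw [Complex.ofReal_cpow (by norm_num)]; norm_num, ← Complex.ofReal_mul,
      ← Real.rpow_add (by norm_num)]
    norm_num
  have d1 := hD.id_mul
  have d2 := hD.deriv.id_mul.id_mul
  have key : PowerSeries.X * (PowerSeries.X * PowerSeries.derivative ℂ (PowerSeries.derivative ℂ F))
        + PowerSeries.C (1 / 3) * (PowerSeries.X * PowerSeries.derivative ℂ F) =
      PowerSeries.X * (PowerSeries.C (2 * x) * (PowerSeries.X * (PowerSeries.X *
          PowerSeries.derivative ℂ (PowerSeries.derivative ℂ F)))
        + (PowerSeries.C (13 / 6 * x) * (PowerSeries.X * PowerSeries.derivative ℂ F)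
        + PowerSeries.C (-x / 36) * F)) +
      PowerSeries.X * (PowerSeries.X * (PowerSeries.C (-1) * (PowerSeries.X * (PowerSeries.X *
          PowerSeries.derivative ℂ (PowerSeries.derivative ℂ F)))
        + (PowerSeries.C (-11 / 6) * (PowerSeries.X * PowerSeries.derivative ℂ F)
        + PowerSeries.C (11 / 144) * F))) := by
    refine (d2.add (d1.const_mul _)).eq_of_punctured
      (((d2.const_mul _).add ((d1.const_mul _).add (hF.const_mul _))).id_mul.add
        ((d2.const_mul _).add ((d1.const_mul _).add (hF.const_mul _))).id_mul.id_mul) ?_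
    filter_upwards [eventually_euler_equation x hG hode hT] with t ht
    linear_combination ht
  have hF' : F = genFunAt x := by
    refine genFunAt_unique h0 ?_ fun n => ?_
    · have h := congrArg (PowerSeries.coeff (0 + 1)) key
      simp only [map_add, PowerSeries.coeff_C_mul, PowerSeries.coeff_succ_X_mul,
        PowerSeries.coeff_derivative, PowerSeries.coeff_zero_X_mul, h0] at h
      push_cast at h
      rw [zero_add] at h
      linear_combination 3 * h
    · have h := congrArg (PowerSeries.coeff (n + 2)) key
      simp only [map_add, PowerSeries.coeff_C_mul, PowerSeries.coeff_succ_X_mul,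
        PowerSeries.coeff_X_mul_derivative, PowerSeries.coeff_X_mul_X_mul_derivative_derivative,
        PowerSeries.coeff_derivative] at h
      push_cast at h
      linear_combination h
  rwa [← hF']

end

/-- All cube roots of `q` are small with `t`. -/
theorem eventually_forall_cube_root (x : ℂ) {P : ℂ → Prop} (hP : ∀ᶠ y in 𝓝 0, P y) :
    ∀ᶠ t in 𝓝 (0 : ℂ), ∀ y : ℂ, y ^ 3 = gegenQ x t → P y := by
  obtain ⟨ε, hε, hball⟩ := Metric.eventually_nhds_iff.1 hP
  have hq : ∀ᶠ t in 𝓝 (0 : ℂ), ‖gegenQ x t‖ < ε ^ 3 :=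
    ((tendsto_gegenQ x).norm).eventually_lt_const (by rw [norm_zero]; positivity)
  filter_upwards [hq] with t hqt y hy
  refine hball ?_
  rw [dist_zero_right]
  refine lt_of_pow_lt_pow_left₀ 3 hε.le ?_
  rwa [← norm_pow, hy]

/-- The closed form of the generating function, with an arbitrary cube root `y` of `q`. -/
theorem eventually_hasSum_genFunAt (x : ℂ) :
    ∀ᶠ t in 𝓝 (0 : ℂ), ∀ y : ℂ, y ^ 3 = gegenQ x t →
      HasSum (fun n => PowerSeries.coeff n (genFunAt x) * t ^ n)
        (gegenP x t ^ (1 / 12 : ℂ) * tetraSum y) := by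
  obtain ⟨G, hG, hGy, hode⟩ := exists_tetraHyp
  have hG0 : G 0 = ((2 ^ (-1 / 12 : ℝ) : ℝ) : ℂ) := by
    rw [← tetraSum_zero, ← hGy.self_of_nhds]; simp
  filter_upwards [genFunAt_hasTaylor x hG hG0 hode, eventually_forall_cube_root x hGy]
    with t ht hyt y hy
  rw [← hyt y hy, hy]
  exact ht

/-! ### Splitting of the principal powers -/

theorem Complex.exp_mul_cpow {z w : ℂ} (a : ℂ) (hw : w ≠ 0) (h : |z.im| + |w.arg| < Real.pi) :
    (exp z * w) ^ a = exp (a * z) * w ^ a := by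
  have hlog : log (exp z * w) = z + log w := by
    have h1 := abs_le.1 (le_refl |z.im|)
    have h2 := abs_le.1 (le_refl |w.arg|)
    conv_lhs => rw [← exp_log hw, ← exp_add]
    rw [log_exp] <;> rw [add_im, log_im] <;> linarith
  rw [cpow_def_of_ne_zero (mul_ne_zero (exp_ne_zero _) hw), cpow_def_of_ne_zero hw, hlog,
    ← exp_add]
  ring_nf

theorem Complex.mul_cpow_of_abs_arg_add_lt {z w : ℂ} (a : ℂ) (hz : z ≠ 0) (hw : w ≠ 0)
    (h : |z.arg| + |w.arg| < Real.pi) : (z * w) ^ a = z ^ a * w ^ a := by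
  conv_lhs => rw [← exp_log hz]
  rw [exp_mul_cpow a hw (by rwa [log_im]), cpow_def_of_ne_zero hz, mul_comm a]

theorem Complex.eventually_abs_arg_lt {α : Type*} {l : Filter α} {f : α → ℂ} {a : ℝ} (ha : 0 < a)
    (h : Tendsto f l (𝓝 (a : ℂ))) {δ : ℝ} (hδ : 0 < δ) :
    ∀ᶠ t in l, f t ≠ 0 ∧ |(f t).arg| < δ := by
  have hc := (continuousAt_arg (ofReal_mem_slitPlane.2 ha)).tendsto.comp h
  refine (h.eventually_ne (by exact_mod_cast ha.ne')).and ?_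
  have := hc.abs.eventually_lt_const (u := δ) (by rwa [arg_ofReal_of_nonneg ha.le, abs_zero])
  exact this

/-- The branch computation common to the two forms: `S`, `C₃`, `S₃` stand for
`sinh ξ, cosh (ξ/3), sinh (ξ/3)` or for `cosh ξ, sinh (ξ/3), cosh (ξ/3)`. All factors other than
powers of `exp ξ` have small argument, so every principal power splits. The critical case is the
fourth root, of `exp (4ξ/3)` times two such factors: `(4/3) (7π/12) + 2 (π/12) < π`. -/
theorem rhs_eq_of_exp {ξ y R p S C₃ S₃ : ℂ} (hR0 : R ≠ 0) (hp0 : p ≠ 0)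
    (hξ : |ξ.im| ≤ 7 * Real.pi / 12)
    (hp : |p.arg| < Real.pi / 12) (hRp : |(R / p).arg| < Real.pi / 12)
    (hu0 : (1 + y + y ^ 2) / 3 ≠ 0) (hu : |((1 + y + y ^ 2) / 3).arg| < Real.pi / 12)
    (hb0 : tetraBase 1 y ≠ 0) (hb : |(tetraBase 1 y).arg| < Real.pi / 12)
    (hb0' : tetraBase (-1) y ≠ 0) (hb' : |(tetraBase (-1) y).arg| < Real.pi / 12)
    (hS : S = Complex.exp ξ * (R / p)) (hC₃ : C₃ = Complex.exp (ξ / 3) * ((1 + y) / 2))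
    (hS₃ : S₃ = Complex.exp (ξ / 3) * ((1 - y) / 2)) (hy : (1 - y ^ 3) / 2 = R / p) :
    (const16 : ℂ) * R ^ (1 / 12 : ℂ) * S ^ (-1 / 3 : ℂ) *
      ((√(√3 + 1) : ℝ) * (S * (1 * C₃ + (S / (3 * S₃)) ^ (1 / 2 : ℂ))) ^ (1 / 4 : ℂ) +
        (√(√3 - 1) : ℝ) * (S * (-1 * C₃ + (S / (3 * S₃)) ^ (1 / 2 : ℂ))) ^ (1 / 4 : ℂ)) =
      p ^ (1 / 12 : ℂ) * tetraSum y := by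
  have hpi := Real.pi_pos
  have hRp0 : R / p ≠ 0 := div_ne_zero hR0 hp0
  have hy1 : 1 - y ≠ 0 := fun h => hRp0 (by rw [← hy]; linear_combination (1 + y + y ^ 2) / 2 * h)
  have hexp : ∀ k : ℕ, Complex.exp (k * (ξ / 3)) = Complex.exp (ξ / 3) ^ k := fun k =>
    Complex.exp_nat_mul _ k
  have hE3 : Complex.exp ξ = Complex.exp (ξ / 3) ^ 3 := by rw [← hexp]; congr 1; push_cast; ring
  have him : ∀ r : ℝ, 0 ≤ r → |((r : ℂ) * ξ).im| ≤ r * (7 * Real.pi / 12) := fun r hr => by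
    rw [Complex.im_ofReal_mul, abs_mul, abs_of_nonneg hr]
    exact mul_le_mul_of_nonneg_left hξ hr
  have hpow : S ^ (-1 / 3 : ℂ) = Complex.exp (-1 / 3 * ξ) * (R / p) ^ (-1 / 3 : ℂ) := by
    rw [hS, Complex.exp_mul_cpow _ hRp0 (by linarith)]
  have hroot : (S / (3 * S₃)) ^ (1 / 2 : ℂ) = Complex.exp (ξ / 3) * tetraRoot y := by
    have h1 : S / (3 * S₃) = Complex.exp ((2 / 3 : ℝ) * ξ) * ((1 + y + y ^ 2) / 3) := by
      have h2 : Complex.exp ((2 / 3 : ℝ) * ξ) = Complex.exp (ξ / 3) ^ 2 := by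
        rw [← hexp]; congr 1; push_cast; ring
      have := Complex.exp_ne_zero (ξ / 3)
      rw [hS, hS₃, h2, hE3, ← hy]
      field_simp
      ring
    have h3 := him (2 / 3) (by norm_num)
    rw [h1, Complex.exp_mul_cpow _ hu0 (by linarith)]
    congr 2
    push_cast; ring
  have hbranch : ∀ e : ℂ, tetraBase e y ≠ 0 → |(tetraBase e y).arg| < Real.pi / 12 →
      (S * (e * C₃ + (S / (3 * S₃)) ^ (1 / 2 : ℂ))) ^ (1 / 4 : ℂ) =
        Complex.exp (ξ / 3) * ((R / p) ^ (1 / 4 : ℂ) * tetraBranch e y) := by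
    intro e h0 harg
    have h1 : S * (e * C₃ + (S / (3 * S₃)) ^ (1 / 2 : ℂ)) =
        Complex.exp (Complex.log (R / p) + (4 / 3 : ℝ) * ξ) * tetraBase e y := by
      have h2 : Complex.exp ((4 / 3 : ℝ) * ξ) = Complex.exp (ξ / 3) ^ 4 := by
        rw [← hexp]; congr 1; push_cast; ring
      rw [hroot, hS, hC₃, Complex.exp_add, Complex.exp_log hRp0, h2, hE3, tetraBase]
      ring
    have h3 := him (4 / 3) (by norm_num)
    have h4 : |(Complex.log (R / p) + (4 / 3 : ℝ) * ξ).im| ≤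
        |(R / p).arg| + |(((4 / 3 : ℝ) : ℂ) * ξ).im| := by
      rw [Complex.add_im, Complex.log_im]; exact abs_add_le _ _
    rw [h1, Complex.exp_mul_cpow _ h0 (by linarith), mul_add, Complex.exp_add,
      Complex.cpow_def_of_ne_zero hRp0, tetraBranch, mul_comm (Complex.log (R / p)),
      show 1 / 4 * (((4 / 3 : ℝ) : ℂ) * ξ) = ξ / 3 by push_cast; ring]
    ring
  have hRpow : R ^ (1 / 12 : ℂ) = (R / p) ^ (1 / 12 : ℂ) * p ^ (1 / 12 : ℂ) := by
    rw [← Complex.mul_cpow_of_abs_arg_add_lt _ hRp0 hp0 (by linarith), div_mul_cancel₀ _ hp0]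
  have hE : Complex.exp (-1 / 3 * ξ) * Complex.exp (ξ / 3) = 1 := by
    rw [← Complex.exp_add, show -1 / 3 * ξ + ξ / 3 = 0 by ring, Complex.exp_zero]
  have hP : (R / p) ^ (1 / 12 : ℂ) * (R / p) ^ (-1 / 3 : ℂ) * (R / p) ^ (1 / 4 : ℂ) = 1 := by
    rw [← Complex.cpow_add _ _ hRp0, ← Complex.cpow_add _ _ hRp0]; norm_num
  rw [hbranch 1 hb0 hb, hbranch (-1) hb0' hb', hpow, hRpow, tetraSum]
  calc _ = (Complex.exp (-1 / 3 * ξ) * Complex.exp (ξ / 3)) *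
        ((R / p) ^ (1 / 12 : ℂ) * (R / p) ^ (-1 / 3 : ℂ) * (R / p) ^ (1 / 4 : ℂ)) *
        (p ^ (1 / 12 : ℂ) * (const16 * ((√(√3 + 1) : ℝ) * tetraBranch 1 y
          + (√(√3 - 1) : ℝ) * tetraBranch (-1) y))) := by ring
    _ = _ := by rw [hE, hP, one_mul, one_mul]

theorem abs_log_im_le {p w : ℂ} (hp0 : p ≠ 0) (hp : |p.arg| < Real.pi / 12) (hw0 : w ≠ 0)
    (hw : 0 ≤ w.re) : |(Complex.log (p / w)).im| ≤ 7 * Real.pi / 12 := by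
  have hpi := Real.pi_pos
  have h1 : |(w⁻¹).arg| ≤ Real.pi / 2 := by
    rw [Complex.abs_arg_le_pi_div_two_iff, Complex.inv_re]
    exact div_nonneg hw (Complex.normSq_nonneg _)
  have h2 := abs_le.1 h1
  have h3 := abs_lt.1 hp
  rw [Complex.log_im, div_eq_mul_inv, Complex.arg_mul hp0 (inv_ne_zero hw0)
    ⟨by linarith, by linarith⟩, abs_le]
  constructor <;> linarith

/-- The smallness conditions on `t` under which the principal powers split. -/
theorem eventually_small_args (x : ℂ) : ∀ᶠ t in 𝓝 (0 : ℂ),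
    (bigR x t ≠ 0 ∧ gegenP x t ≠ 0 ∧ |(gegenP x t).arg| < Real.pi / 12 ∧
      |(bigR x t / gegenP x t).arg| < Real.pi / 12) ∧
    ∀ y : ℂ, y ^ 3 = gegenQ x t →
      ((1 + y + y ^ 2) / 3 ≠ 0 ∧ |((1 + y + y ^ 2) / 3).arg| < Real.pi / 12) ∧
      (tetraBase 1 y ≠ 0 ∧ |(tetraBase 1 y).arg| < Real.pi / 12) ∧
      (tetraBase (-1) y ≠ 0 ∧ |(tetraBase (-1) y).arg| < Real.pi / 12) := by
  have hδ : 0 < Real.pi / 12 := by positivity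
  have hR : Tendsto (bigR x) (𝓝 0) (𝓝 1) := by
    simpa [ContinuousAt, bigR_zero] using (analyticAt_bigR x).continuousAt
  have hp := tendsto_gegenP x
  have h1 := Complex.eventually_abs_arg_lt (a := 2) two_pos (by exact_mod_cast hp) hδ
  have h2 := Complex.eventually_abs_arg_lt (a := 1 / 2) (f := fun t => bigR x t / gegenP x t)
    (by norm_num) (by push_cast; exact hR.div hp two_ne_zero) hδ
  have hu : Tendsto (fun y : ℂ => (1 + y + y ^ 2) / 3) (𝓝 0) (𝓝 ((1 / 3 : ℝ) : ℂ)) := by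
    have hc : Continuous fun y : ℂ => (1 + y + y ^ 2) / 3 := by fun_prop
    simpa using hc.tendsto 0
  have hb : ∀ e : ℝ, Tendsto (tetraBase e) (𝓝 0) (𝓝 ((1 / √3 + e / 2 : ℝ) : ℂ)) := fun e => by
    rw [← tetraBase_zero]
    exact (continuousAt_tetraRoot eventually_mem_slitPlane_tetraRoot.self_of_nhds).add
      (f := tetraRoot) (g := fun y : ℂ => (e : ℂ) * ((1 + y) / 2)) (by fun_prop)
  have h3 := Complex.eventually_abs_arg_lt (by norm_num) hu hδ
  have h4 := Complex.eventually_abs_arg_lt (one_div_sqrt_three_add_pos (e := 1) (by norm_num))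
    (hb 1) hδ
  have h5 := Complex.eventually_abs_arg_lt (one_div_sqrt_three_add_pos (e := -1) (by norm_num))
    (hb (-1)) hδ
  push_cast at h4 h5
  filter_upwards [h1, h2, eventually_forall_cube_root x (h3.and (h4.and h5))] with t h1 h2 h3
  exact ⟨⟨(div_ne_zero_iff.1 h2.1).1, h1.1, h1.2, h2.2⟩, h3⟩

/-- The product `(1 - xt - R) (1 - xt + R)`. -/
theorem gegenP_mul (x t : ℂ) :
    (1 - bigR x t - x * t) * gegenP x t = t ^ 2 * (x ^ 2 - 1) := by
  rw [gegenP]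
  linear_combination -bigR_sq x t

theorem coeff_genFunAt_mul (x t : ℂ) : (fun n => PowerSeries.coeff n (genFunAt x) * t ^ n) =
    fun n : ℕ => coeff16 n * (gegenbauer (1 / 6) n).eval x * t ^ n := by
  funext n; rw [genFunAt, PowerSeries.coeff_mk]

theorem hasSum_rhsF {x : ℂ} (hx : x ^ 2 ≠ 1) : ∀ᶠ t in 𝓝 (0 : ℂ), ∀ s : ℂ, t ≠ 0 →
    s ^ 2 = x ^ 2 - 1 → 0 ≤ (t * s).re → 1 - bigR x t - x * t ≠ 0 ∧
      HasSum (fun n : ℕ => coeff16 n * (gegenbauer (1 / 6) n).eval x * t ^ n)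
        (rhsF x t (Complex.log (t * s / (1 - bigR x t - x * t)))) := by
  filter_upwards [eventually_small_args x, eventually_hasSum_genFunAt x]
    with t ⟨⟨hR0, hp0, hp, hRp⟩, hy⟩ hsum s ht hs hre
  have hm := gegenP_mul x t
  have hs0 : s ≠ 0 := fun h => hx (by rw [h] at hs; linear_combination -hs)
  have hts : t * s ≠ 0 := mul_ne_zero ht hs0
  have hm0 : 1 - bigR x t - x * t ≠ 0 := fun h => by
    rw [h, zero_mul, ← hs, ← mul_pow] at hm
    exact hts (pow_eq_zero_iff two_ne_zero |>.1 hm.symm)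
  refine ⟨hm0, ?_⟩
  have hw : t * s / (1 - bigR x t - x * t) = gegenP x t / (t * s) := by
    rw [div_eq_div_iff hm0 hts]
    linear_combination t ^ 2 * hs - hm
  rw [hw]
  have hξ := abs_log_im_le hp0 hp hts hre
  have hexp : Complex.exp (Complex.log (gegenP x t / (t * s))) = gegenP x t / (t * s) :=
    Complex.exp_log (div_ne_zero hp0 hts)
  set ξ := Complex.log (gegenP x t / (t * s))
  have hcube : Complex.exp ξ = Complex.exp (ξ / 3) ^ 3 := by
    rw [← Complex.exp_nat_mul]; congr 1; push_cast; ring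
  set E := Complex.exp (ξ / 3) with hE
  have hE0 : E ≠ 0 := Complex.exp_ne_zero _
  set y : ℂ := (E⁻¹) ^ 2 with hyE
  have hyq : y ^ 3 = gegenQ x t := by
    rw [show y ^ 3 = ((E ^ 3)⁻¹) ^ 2 by rw [hyE]; field_simp, ← hcube, hexp, gegenQ]
    field_simp
    linear_combination t ^ 2 * hs - hm
  obtain ⟨⟨hu0, hu⟩, ⟨hb0, hb⟩, ⟨hb0', hb'⟩⟩ := hy y hyq
  have hy3 : (1 - y ^ 3) / 2 = bigR x t / gegenP x t := by
    rw [hyq, one_sub_gegenQ hp0]; ring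
  have h := rhs_eq_of_exp (S := Complex.sinh ξ) (C₃ := Complex.cosh (ξ / 3))
    (S₃ := Complex.sinh (ξ / 3)) hR0 hp0 hξ hp hRp hu0 hu hb0 hb hb0' hb'
    (by rw [Complex.sinh, Complex.exp_neg, ← hy3, hcube, hyE]; field_simp)
    (by rw [Complex.cosh, Complex.exp_neg, ← hE, hyE]; field_simp)
    (by rw [Complex.sinh, Complex.exp_neg, ← hE, hyE]; field_simp) hy3
  have hsum' := hsum y hyq
  rw [← h, coeff_genFunAt_mul] at hsum'
  exact hsum'

theorem hasSum_rhsG {x : ℂ} (hx : x ^ 2 ≠ 1) : ∀ᶠ t in 𝓝 (0 : ℂ), ∀ s : ℂ, t ≠ 0 →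
    s ^ 2 = 1 - x ^ 2 → 0 ≤ (t * s).re → -1 + bigR x t + x * t ≠ 0 ∧
      HasSum (fun n : ℕ => coeff16 n * (gegenbauer (1 / 6) n).eval x * t ^ n)
        (rhsG x t (Complex.log (t * s / (-1 + bigR x t + x * t)))) := by
  filter_upwards [eventually_small_args x, eventually_hasSum_genFunAt x]
    with t ⟨⟨hR0, hp0, hp, hRp⟩, hy⟩ hsum s ht hs hre
  have hm : (-1 + bigR x t + x * t) * gegenP x t = t ^ 2 * (1 - x ^ 2) := by
    linear_combination -gegenP_mul x t
  have hs0 : s ≠ 0 := fun h => hx (by rw [h] at hs; linear_combination hs)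
  have hts : t * s ≠ 0 := mul_ne_zero ht hs0
  have hm0 : -1 + bigR x t + x * t ≠ 0 := fun h => by
    rw [h, zero_mul, ← hs, ← mul_pow] at hm
    exact hts (pow_eq_zero_iff two_ne_zero |>.1 hm.symm)
  refine ⟨hm0, ?_⟩
  have hw : t * s / (-1 + bigR x t + x * t) = gegenP x t / (t * s) := by
    rw [div_eq_div_iff hm0 hts]
    linear_combination t ^ 2 * hs - hm
  rw [hw]
  have hξ := abs_log_im_le hp0 hp hts hre
  have hexp : Complex.exp (Complex.log (gegenP x t / (t * s))) = gegenP x t / (t * s) :=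
    Complex.exp_log (div_ne_zero hp0 hts)
  set ξ := Complex.log (gegenP x t / (t * s))
  have hcube : Complex.exp ξ = Complex.exp (ξ / 3) ^ 3 := by
    rw [← Complex.exp_nat_mul]; congr 1; push_cast; ring
  set E := Complex.exp (ξ / 3) with hE
  have hE0 : E ≠ 0 := Complex.exp_ne_zero _
  -- The sign turns hyperbolic sines into cosines and conversely.
  set y : ℂ := -(E⁻¹) ^ 2 with hyE
  have hyq : y ^ 3 = gegenQ x t := by
    rw [show y ^ 3 = -((E ^ 3)⁻¹) ^ 2 by rw [hyE]; field_simp, ← hcube, hexp, gegenQ]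
    field_simp
    linear_combination hm - t ^ 2 * hs
  obtain ⟨⟨hu0, hu⟩, ⟨hb0, hb⟩, ⟨hb0', hb'⟩⟩ := hy y hyq
  have hy3 : (1 - y ^ 3) / 2 = bigR x t / gegenP x t := by
    rw [hyq, one_sub_gegenQ hp0]; ring
  have h := rhs_eq_of_exp (S := Complex.cosh ξ) (C₃ := Complex.sinh (ξ / 3))
    (S₃ := Complex.cosh (ξ / 3)) hR0 hp0 hξ hp hRp hu0 hu hb0 hb hb0' hb'
    (by rw [Complex.cosh, Complex.exp_neg, ← hy3, hcube, hyE]; field_simp; ring)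
    (by rw [Complex.sinh, Complex.exp_neg, ← hE, hyE]; field_simp; ring)
    (by rw [Complex.cosh, Complex.exp_neg, ← hE, hyE]; field_simp; ring) hy3
  have hsum' := hsum y hyq
  rw [← h, coeff_genFunAt_mul] at hsum'
  exact hsum'

/-! ### Algebraicity -/

theorem hasTaylor_genFunAt (x : ℂ) : HasTaylor (genFunAt x)
    (fun t => gegenP x t ^ (1 / 12 : ℂ) * tetraSum (gegenQ x t ^ (1 / 3 : ℂ))) := by
  filter_upwards [eventually_hasSum_genFunAt x] with t ht
  exact ht _ (by rw [← Complex.cpow_nat_mul]; norm_num)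

/-- The pairs `(x, t)` at which `p` does not vanish. -/
abbrev GegenDomain : Type := {d : ℂ × ℂ // gegenP d.1 d.2 ≠ 0}

/-- Evaluation of polynomials in `x` and `t` as functions on `GegenDomain`. -/
noncomputable def domainEval : ℂ[X][X] →+* (GegenDomain → ℂ) :=
  RingHom.pi fun d => evalEvalRingHom d.1.1 d.1.2

theorem domainEval_apply (c : ℂ[X][X]) (d : GegenDomain) :
    domainEval c d = c.evalEval d.1.1 d.1.2 := rfl

/-- The closed form of the generating function is integral over the polynomial functions: after
multiplication by the powers of `p` that occur, it is built from `x` and `t` by ring operations and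
extraction of roots, without denominators. -/
theorem isIntegralElem_closedForm : domainEval.IsIntegralElem fun d =>
    gegenP d.1.1 d.1.2 ^ (1 / 12 : ℂ) * tetraSum (gegenQ d.1.1 d.1.2 ^ (1 / 3 : ℂ)) := by
  let : Algebra ℂ[X][X] (GegenDomain → ℂ) := domainEval.toAlgebra
  have hroot : ∀ {f g : GegenDomain → ℂ} (n : ℕ), 0 < n → IsIntegral ℂ[X][X] g →
      (∀ d, f d ^ n = g d) → IsIntegral ℂ[X][X] f := fun n hn hg h =>
    IsIntegral.of_pow hn (by rwa [show _ ^ n = _ from _root_.funext h])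
  have hconst : ∀ c : ℂ, IsIntegral ℂ[X][X] (fun _ : GegenDomain => c) := fun c => by
    have h := isIntegral_algebraMap (R := ℂ[X][X]) (A := GegenDomain → ℂ) (x := C (C c))
    convert! h using 1
    funext d
    simp [RingHom.algebraMap_toAlgebra, domainEval_apply, evalEval_C]
  have hx : IsIntegral ℂ[X][X] (fun d : GegenDomain => d.1.1) := by
    have h := isIntegral_algebraMap (R := ℂ[X][X]) (A := GegenDomain → ℂ) (x := C X)
    convert! h using 1
    funext d
    simp [RingHom.algebraMap_toAlgebra, domainEval_apply, evalEval_C]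
  have ht : IsIntegral ℂ[X][X] (fun d : GegenDomain => d.1.2) := by
    have h := isIntegral_algebraMap (R := ℂ[X][X]) (A := GegenDomain → ℂ) (x := X)
    convert! h using 1
    funext d
    simp [RingHom.algebraMap_toAlgebra, domainEval_apply]
  have hR : IsIntegral ℂ[X][X] (fun d : GegenDomain => bigR d.1.1 d.1.2) :=
    hroot 2 two_pos ((((hconst 1).sub (((hconst 2).mul hx).mul ht)).add (ht.pow 2)))
      fun d => bigR_sq _ _
  have hc : IsIntegral ℂ[X][X] (fun d : GegenDomain => 1 - d.1.1 * d.1.2) :=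
    (hconst 1).sub (hx.mul ht)
  have hP : IsIntegral ℂ[X][X] (fun d : GegenDomain => gegenP d.1.1 d.1.2 ^ (1 / 3 : ℂ)) :=
    hroot 3 three_pos (hc.add hR) fun d => by
      rw [← Complex.cpow_nat_mul]; norm_num; rfl
  have hcube : ∀ z : ℂ, (z ^ (1 / 3 : ℂ)) ^ 3 = z := fun z => by
    rw [← Complex.cpow_nat_mul]; norm_num
  have hM : IsIntegral ℂ[X][X] (fun d : GegenDomain =>
      gegenP d.1.1 d.1.2 ^ (1 / 3 : ℂ) * gegenQ d.1.1 d.1.2 ^ (1 / 3 : ℂ)) :=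
    hroot 3 three_pos (hc.sub hR) fun d => by
      rw [mul_pow, hcube, hcube, gegenQ, mul_div_cancel₀ _ d.2]; rfl
  have hW : IsIntegral ℂ[X][X] (fun d : GegenDomain =>
      gegenP d.1.1 d.1.2 ^ (1 / 3 : ℂ) * tetraRoot (gegenQ d.1.1 d.1.2 ^ (1 / 3 : ℂ))) :=
    hroot 2 two_pos ((((hP.pow 2).add (hP.mul hM)).add (hM.pow 2)).mul (hconst (1 / 3)))
      fun d => by
        rw [mul_pow, tetraRoot_sq]
        simp only [Pi.add_apply, Pi.mul_apply, Pi.pow_apply]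
        ring
  have hH : ∀ e : ℂ, IsIntegral ℂ[X][X] (fun d : GegenDomain =>
      gegenP d.1.1 d.1.2 ^ (1 / 3 : ℂ) * tetraBase e (gegenQ d.1.1 d.1.2 ^ (1 / 3 : ℂ))) :=
    fun e => by
      convert! hW.add ((hconst (e / 2)).mul (hP.add hM)) using 1
      funext d
      simp only [Pi.add_apply, Pi.mul_apply, tetraBase]
      ring
  have hZ : ∀ e : ℂ, IsIntegral ℂ[X][X] (fun d : GegenDomain =>
      gegenP d.1.1 d.1.2 ^ (1 / 12 : ℂ) * tetraBranch e (gegenQ d.1.1 d.1.2 ^ (1 / 3 : ℂ))) :=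
    fun e => hroot 12 (by norm_num) ((hH e).pow 3) fun d => by
      simp only [Pi.pow_apply]
      rw [mul_pow, mul_pow, hcube, tetraBranch, ← Complex.cpow_nat_mul, ← Complex.cpow_nat_mul,
        ← Complex.cpow_natCast _ 3]
      norm_num
  have h := (hconst const16).mul (((hconst (√(√3 + 1) : ℝ)).mul (hZ 1)).add
    ((hconst (√(√3 - 1) : ℝ)).mul (hZ (-1))))
  change IsIntegral ℂ[X][X] _
  convert! h using 1
  funext d
  simp only [Pi.add_apply, Pi.mul_apply, tetraSum]
  ring

theorem hasTaylor_evalEval (x : ℂ) (c : ℂ[X][X]) :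
    HasTaylor (PowerSeries.map (evalRingHom x) (c : PowerSeries ℂ[X])) fun t => c.evalEval x t := by
  induction c using Polynomial.induction_on with
  | C a => simpa [evalEval_C] using HasTaylor.const (a.eval x)
  | add p q hp hq => simpa using hp.add hq
  | monomial n a h =>
    convert! h.id_mul using 1
    · rw [pow_succ', ← mul_assoc, mul_comm (C a) X, mul_assoc]
      simp
    · funext t
      simp [pow_succ]
      ring

theorem hasTaylor_eval₂ {x : ℂ} {F : PowerSeries ℂ} {T : ℂ → ℂ} (hF : HasTaylor F T)
    (f : ℂ[X][X][X]) :
    HasTaylor (f.eval₂ ((PowerSeries.map (evalRingHom x)).comp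
      (algebraMap ℂ[X][X] (PowerSeries ℂ[X]))) F) fun t => f.eval₂ (evalEvalRingHom x t) (T t) := by
  induction f using Polynomial.induction_on with
  | C a =>
    have ha : algebraMap ℂ[X][X] (PowerSeries ℂ[X]) a = a := by
      simp [PowerSeries.algebraMap_apply']
    simp only [eval₂_C, RingHom.comp_apply, ha]
    exact hasTaylor_evalEval x a
  | add p q hp hq => simpa using hp.add hq
  | monomial n a h =>
    convert! h.mul hF using 1
    · rw [pow_succ, ← mul_assoc, eval₂_mul_X]
    · funext t
      rw [pow_succ, ← mul_assoc, eval₂_mul_X]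

theorem map_genFun16 (x : ℂ) : PowerSeries.map (evalRingHom x) genFun16 = genFunAt x := by
  ext n
  simp [genFun16, genFunAt]

/-- The monic relation between functions of `(x, t)` passes to the Taylor series at each `x`, and a
polynomial in `x` that vanishes everywhere is zero. -/
theorem isAlgebraic_genFun16 : IsAlgebraic ℂ[X][X] genFun16 := by
  obtain ⟨f, hf, hf0⟩ := isIntegralElem_closedForm
  refine ⟨f, hf.ne_zero, ?_⟩
  have hx : ∀ x : ℂ, PowerSeries.map (evalRingHom x) (aeval genFun16 f) = 0 := fun x => by
    rw [aeval_def, hom_eval₂, map_genFun16]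
    have hT := hasTaylor_eval₂ (x := x) (hasTaylor_genFunAt x) f
    have h0 := HasTaylor.const 0
    rw [map_zero] at h0
    refine hT.unique_left (h0.congr ?_)
    filter_upwards [eventually_gegenP_mem_slitPlane x] with t ht
    have h := congrArg (Pi.evalRingHom (fun _ : GegenDomain => ℂ)
      ⟨(x, t), Complex.slitPlane_ne_zero ht⟩) hf0
    rw [hom_eval₂, map_zero] at h
    exact h.symm
  ext1 n
  refine Polynomial.funext fun x => ?_
  have h := congrArg (PowerSeries.coeff n) (hx x)
  simpa using h

theorem mainTheorem5 :
    -- first form, with `s` a square root of `x² - 1`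
    (∀ x : ℂ, x ^ 2 ≠ 1 → ∃ r : ℝ, 0 < r ∧ ∀ t s : ℂ, t ≠ 0 → ‖t‖ < r →
      s ^ 2 = x ^ 2 - 1 → 0 ≤ (t * s).re →
        1 - bigR x t - x * t ≠ 0 ∧
        HasSum (fun n : ℕ => coeff16 n * (gegenbauer (1 / 6) n).eval x * t ^ n)
          (rhsF x t (Complex.log (t * s / (1 - bigR x t - x * t))))) ∧
    -- second form, with `s` a square root of `1 - x²`
    (∀ x : ℂ, x ^ 2 ≠ 1 → ∃ r : ℝ, 0 < r ∧ ∀ t s : ℂ, t ≠ 0 → ‖t‖ < r →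
      s ^ 2 = 1 - x ^ 2 → 0 ≤ (t * s).re →
        -1 + bigR x t + x * t ≠ 0 ∧
        HasSum (fun n : ℕ => coeff16 n * (gegenbauer (1 / 6) n).eval x * t ^ n)
          (rhsG x t (Complex.log (t * s / (-1 + bigR x t + x * t))))) ∧
    -- the generating function is algebraic over `ℂ[x][t]`
    IsAlgebraic ℂ[X][X] genFun16 := by
  refine ⟨fun x hx => ?_, fun x hx => ?_, isAlgebraic_genFun16⟩
  · obtain ⟨r, hr, h⟩ := Metric.eventually_nhds_iff.1 (hasSum_rhsF hx)
    exact ⟨r, hr, fun t s ht htr => h (by rwa [dist_zero_right]) s ht⟩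
  · obtain ⟨r, hr, h⟩ := Metric.eventually_nhds_iff.1 (hasSum_rhsG hx)
    exact ⟨r, hr, fun t s ht htr => h (by rwa [dist_zero_right]) s ht⟩
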